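/- Theorem 3.2 (Expectation of Betti numbers, random Čech complex). Let $d\ge 2$ and $1\le k\le d-1$ be integers, and let $f:\mathbb{R}^d\to[0,\infty)$ be a bounded Lebesgue-measurable function with $\int_{\mathbb{R}^d} f(x)\,dx=1$. Then there is a constant $D_k>0$, depending only on $k$ and the density $f$ (and hence on $d$), such that the following holds. Let $\epsilon>0$, let $(r_n)$ be a sequence of positive reals with $r_n=O(n^{-1/d-\epsilon})$, let $x_1,x_2,\dots$ be independent random points of $\mathbb{R}^d$ with common density $f$, and put $X_n=\{x_1,\dots,x_n\}$. Let $C(X_n;r_n)$ be the random Čech complex: its vertex set is $X_n$, and a nonempty subset $\sigma\subseteq X_n$ is a face if and only if $\bigcap_{x\in\sigma}B(x,r_n/2)\neq\emptyset$, where $B(x,\rho)$ is the closed Euclidean ball of radius $\rho$ centred at $x$. Let $\beta_k$ be the dimension of the simplicial homology $H_k(C(X_n;r_n);F)$ over a field $F$ (any field is allowed, and $D_k$ does not depend on it), and let $\widetilde S_k$ be the number of connected components of $C(X_n;r_n)$ that are isomorphic to the boundary of a $(k+1)$-dimensional simplex. Then, as $n\to\infty$, $$\frac{E[\beta_k]}{n^{k+2}\,r_n^{d(k+1)}}\;\longrightarrow\;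 D_k ,$$ and the dominant contribution comes from components that are boundaries of $(k+1)$-simplices, in the sense that $$\frac{E[\beta_k]}{E[\widetilde S_k]}\;\longrightarrow\;1 .$$ -/

import Mathlib

open MeasureTheory ProbabilityTheory Filter Topology Asymptotics

noncomputable section

namespace CechBetti

/-! ### Simplicial homology of an abstract simplicial complex with ordered vertices -/

section Homology

variable {V : Type*} [LinearOrder V]

/-- The simplicial boundary operator with coefficients in `F`, on formal combinations of finite
vertex sets: if `s = {v₀ < ⋯ < vₖ}` then `∂ s = ∑ᵢ (-1)ⁱ (s \ {vᵢ})`, where the index `i` of `v` is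
the number of elements of `s` below `v`. The empty set is never a simplex, so `∂ {v} = 0`
(the homology is not reduced). -/
def boundary (F V : Type*) [Field F] [LinearOrder V] :
    (Finset V →₀ F) →ₗ[F] (Finset V →₀ F) :=
  Finsupp.linearCombination F fun s : Finset V =>
    ∑ v ∈ s with (s.erase v).Nonempty,
      Finsupp.single (s.erase v) ((-1 : F) ^ (s.filter (· < v)).card)

/-- `∂ ∘ ∂ = 0` on a basis element. -/
lemma boundary_boundary_single (F V : Type*) [Field F] [LinearOrder V] (s : Finset V) :
    boundary F V (boundary F V (Finsupp.single s 1)) = 0 := by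
  have key : ∀ s : Finset V, ∀ a : F, boundary F V (Finsupp.single s a) = a • ∑ v ∈ s with (s.erase v).Nonempty,
      Finsupp.single (s.erase v) ((-1 : F) ^ (s.filter (· < v)).card) := by
    intro s a; simp [boundary, Finsupp.linearCombination_single]
  rw [key, one_smul, map_sum]
  simp only [key, Finset.smul_sum]
  rw [Finset.sum_sigma']
  refine Finset.sum_involution (fun p _ => ⟨p.2, p.1⟩) ?_ ?_ ?_ ?_
  · rintro ⟨v, w⟩ h
    simp only [Finset.mem_sigma, Finset.mem_filter, Finset.mem_erase] at h
    obtain ⟨⟨hv, -⟩, ⟨hwv, hw⟩, -⟩ := h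
    simp only [Finset.erase_right_comm (a := w) (b := v), Finsupp.smul_single, smul_eq_mul, ← Finsupp.single_add]
    have e1 : ∀ a b : V, (s.erase a).filter (· < b) = (s.filter (· < b)).erase a := by
      intro a b; ext x; simp; tauto
    rw [e1, e1, Finset.card_erase_eq_ite, Finset.card_erase_eq_ite]
    have : (-1 : F) ^ (s.filter (· < v)).card * (-1) ^ (if v ∈ s.filter (· < w) then (s.filter (· < w)).card - 1 else (s.filter (· < w)).card) + (-1) ^ (s.filter (· < w)).card * (-1) ^ (if w ∈ s.filter (· < v) then (s.filter (· < v)).card - 1 else (s.filter (· < v)).card) = 0 := by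
      rcases lt_or_gt_of_ne hwv with h | h
      · have : w ∈ s.filter (· < v) := by simp [hw, h]
        obtain ⟨m, hm⟩ := Nat.exists_eq_succ_of_ne_zero (Finset.card_ne_zero_of_mem this)
        simp [hw, hv, h, h.not_gt, hm, pow_succ]; ring
      · have : v ∈ s.filter (· < w) := by simp [hv, h]
        obtain ⟨m, hm⟩ := Nat.exists_eq_succ_of_ne_zero (Finset.card_ne_zero_of_mem this)
        simp [hw, hv, h, h.not_gt, hm, pow_succ]; ring
    rw [this]; simp
  · rintro ⟨v, w⟩ h h2 h3
    simp only [Finset.mem_sigma, Finset.mem_filter, Finset.mem_erase] at h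
    simp at h3; exact h.2.1.1 (by simpa using h3.1)
  · rintro ⟨v, w⟩ h
    simp only [Finset.mem_sigma, Finset.mem_filter, Finset.mem_erase] at h ⊢
    refine ⟨⟨h.2.1.2, ⟨v, ?_⟩⟩, ⟨h.2.1.1.symm, h.1.1⟩, ?_⟩
    · simp [h.1.1, h.2.1.1.symm]
    · rw [Finset.erase_right_comm]; exact h.2.2
  · rintro ⟨v, w⟩ h; rfl

/-- The simplicial `k`-chains of `K`: combinations of faces with `k + 1` vertices. -/
def chains (F : Type*) [Field F] (K : PreAbstractSimplicialComplex V) (k : ℕ) :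
    Submodule F (Finset V →₀ F) :=
  Finsupp.supported F F {s | s ∈ K.faces ∧ s.card = k + 1}

/-- The simplicial `k`-cycles of `K`. -/
def cycles (F : Type*) [Field F] (K : PreAbstractSimplicialComplex V) (k : ℕ) :
    Submodule F (Finset V →₀ F) :=
  chains F K k ⊓ LinearMap.ker (boundary F V)

/-- The simplicial `k`-boundaries of `K`. -/
def boundaries (F : Type*) [Field F] (K : PreAbstractSimplicialComplex V) (k : ℕ) :
    Submodule F (Finset V →₀ F) :=
  (chains F K (k + 1)).map (boundary F V)

/-- Boundaries are cycles. -/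
lemma boundaries_le_cycles (F : Type*) [Field F] (K : PreAbstractSimplicialComplex V) (k : ℕ) :
    boundaries F K k ≤ cycles F K k := by
  rw [boundaries, chains, Finsupp.supported_eq_span_single, Submodule.map_span, Submodule.span_le]
  rintro _ ⟨_, ⟨s, ⟨hs, hc⟩, rfl⟩, rfl⟩
  refine ⟨?_, boundary_boundary_single F V s⟩
  have h1 : boundary F V (Finsupp.single s 1) = ∑ v ∈ s with (s.erase v).Nonempty,
      Finsupp.single (s.erase v) ((-1 : F) ^ (s.filter (· < v)).card) := by
    simp [boundary, Finsupp.linearCombination_single]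
  rw [h1]
  refine Submodule.sum_mem _ fun v hv => ?_
  rw [Finset.mem_filter] at hv
  refine Finsupp.single_mem_supported F _ ⟨?_, ?_⟩
  · exact (K.isRelLowerSet_faces hs).2 (Finset.erase_subset v s) hv.2
  · rw [Finset.card_erase_of_mem hv.1, hc]; rfl

/-- The dimension of the quotient `Z / B`, for subspaces `B ⊆ Z` of an `F`-vector space. -/
def quotientDim {F M : Type*} [Field F] [AddCommGroup M] [Module F M] (Z B : Submodule F M) : ℕ :=
  Module.finrank F (Z ⧸ B.submoduleOf Z)

/-- The `k`-th Betti number of `K` over `F`: the dimension over `F` of the simplicial homology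
`Hₖ(K; F)`, that is, of cycles modulo boundaries. -/
def betti (F : Type*) [Field F] (K : PreAbstractSimplicialComplex V) (k : ℕ) : ℕ :=
  quotientDim (cycles F K k) (boundaries F K k)

end Homology

/-! ### Connected components of a complex; boundaries of simplices -/

section Components

variable {V W : Type*}

/-- The graph whose edges are the one-dimensional faces of `K`. -/
def edgeGraph [DecidableEq V] (K : PreAbstractSimplicialComplex V) : SimpleGraph V where
  Adj v w := v ≠ w ∧ ({v, w} : Finset V) ∈ K.faces
  symm := ⟨fun v w h => ⟨h.1.symm, by rw [Finset.pair_comm]; exact h.2⟩⟩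
  loopless := ⟨fun _ h => h.1 rfl⟩

/-- The subcomplex of `K` consisting of the faces all of whose vertices lie in `U`. -/
def inducedSubcomplex (K : PreAbstractSimplicialComplex V) (U : Set V) :
    PreAbstractSimplicialComplex V where
  faces := {s | s ∈ K.faces ∧ (s : Set V) ⊆ U}
  isRelLowerSet_faces := fun _ hs =>
    ⟨(K.isRelLowerSet_faces hs.1).1, fun _ hts ht =>
      ⟨(K.isRelLowerSet_faces hs.1).2 hts ht, (Finset.coe_subset.2 hts).trans hs.2⟩⟩

/-- Two complexes are isomorphic if a bijection between their vertex sets identifies the faces. -/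
def Isomorphic (K : PreAbstractSimplicialComplex V) (L : PreAbstractSimplicialComplex W) : Prop :=
  ∃ e : {v : V // ({v} : Finset V) ∈ K.faces} ≃ {w : W // ({w} : Finset W) ∈ L.faces},
    ∀ s : Finset {v : V // ({v} : Finset V) ∈ K.faces},
      s.map (Function.Embedding.subtype _) ∈ K.faces ↔
        (s.map e.toEmbedding).map (Function.Embedding.subtype _) ∈ L.faces

/-- The boundary of the `m`-dimensional simplex: all proper nonempty subsets of its `m + 1`
vertices. -/
def simplexBoundary (m : ℕ) : PreAbstractSimplicialComplex (Fin (m + 1)) where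
  faces := {s | s.Nonempty ∧ s ≠ Finset.univ}
  isRelLowerSet_faces := fun _ hs =>
    ⟨hs.1, fun _ hts ht =>
      ⟨ht, fun h => hs.2 (Finset.univ_subset_iff.1 (h ▸ hts))⟩⟩

/-- The number of connected components of `K` that are isomorphic to the boundary of the
`m`-dimensional simplex. -/
def simplexBoundaryComponents [DecidableEq V] (K : PreAbstractSimplicialComplex V) (m : ℕ) : ℕ :=
  Set.ncard {c : (edgeGraph K).ConnectedComponent |
    Isomorphic (inducedSubcomplex K c.supp) (simplexBoundary m)}

end Components

/-! ### The Čech complex -/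

/-- The Čech complex of a family of points: a nonempty finite set `σ` of labels is a face when the
closed balls of radius `r / 2` around the points of `σ` have a common point. -/
def cechComplex {ι E : Type*} [PseudoMetricSpace E] (x : ι → E) (r : ℝ) :
    PreAbstractSimplicialComplex ι where
  faces := {σ | σ.Nonempty ∧ (⋂ i ∈ σ, Metric.closedBall (x i) (r / 2)).Nonempty}
  isRelLowerSet_faces := fun _ hs =>
    ⟨hs.1, fun _ hts ht =>
      ⟨ht, hs.2.mono (Set.biInter_subset_biInter_left hts)⟩⟩

/-- The random Čech complex `C(Xₙ; r)` at the outcome `ω`, on the first `n` points of a random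
sequence. The vertex set is the set of labels of the points; for points with a density, distinct
labels almost surely carry distinct points. -/
def randomCech {Ω : Type*} {d : ℕ} (X : ℕ → Ω → EuclideanSpace ℝ (Fin d)) (n : ℕ) (r : ℝ) (ω : Ω) :
    PreAbstractSimplicialComplex (Fin n) :=
  cechComplex (fun i : Fin n => X i ω) r

end CechBetti

end

noncomputable section

namespace CechBetti

/-! ### Dimension bounds for quotients by means of linear maps -/

section LinearAlgebra

variable {F M N : Type*} [Field F] [AddCommGroup M] [Module F M] [AddCommGroup N] [Module F N]

/-! In the sparse regime homology in degree `k` should come from the smallest possible cycles,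
namely `k + 2` vertices that span a hollow simplex and touch nothing else. The isolated hollow sets
are exactly the components counted by `simplexBoundaryComponents`. They give independent classes
(`card_isolatedHollow_le_betti`), and they give all classes up to an error bounded by the number of
crowded faces (`betti_le`).

A crowded face, or a hollow set that is not isolated, lies in a set of `k + 3` points of diameter at
most `3r`. So the Betti number, the number of components and the number of all hollow sets differ
pairwise by at most `2 ^ (k + 3)` times the number of such close sets. The expected number of close
sets is `O(n ^ (k + 3) * r ^ (d * (k + 2)))`, which is the normalisation `n ^ (k + 2) * r ^ (d * (k
+ 1))` times `n * r ^ d`, and `n * r ^ d` tends to `0`.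

It remains to count hollow sets. The expectation is `n.choose (k + 2)` times the probability that `k
+ 2` points are hollow. Writing the points as `a` and `a + r • z i` extracts `r ^ (d * (k + 1))`
(`hollowProb_eq`), and continuity of translations in L¹ gives the limit of the remaining integral
(`tendsto_hollowProb_div`). The constant is the volume of the hollow configurations times the
integral of the density to the power `k + 2`, divided by `(k + 2)!`. It is positive because `k + 1 ≤
d` leaves room for a hollow simplex that survives small perturbations. Both expectations have this
normalised limit, so their ratio tends to `1`. -/

lemma quotientDim_le_finrank [FiniteDimensional F M] [FiniteDimensional F N]
    {Z B : Submodule F M} (φ : M →ₗ[F] N) (h : ∀ z ∈ Z, φ z = 0 → z ∈ B) :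
    quotientDim Z B ≤ Module.finrank F N := by
  let ψ : Z →ₗ[F] N := φ.comp Z.subtype
  have hker : LinearMap.ker ψ ≤ B.submoduleOf Z := fun z hz => h z z.2 hz
  calc quotientDim Z B ≤ Module.finrank F (Z ⧸ LinearMap.ker ψ) :=
        LinearMap.finrank_le_finrank_of_surjective (f := Submodule.factor hker)
          (Submodule.factor_surjective hker)
    _ = Module.finrank F (LinearMap.range ψ) := ψ.quotKerEquivRange.finrank_eq
    _ ≤ _ := Submodule.finrank_le _

lemma finrank_le_quotientDim [FiniteDimensional F M] {Z B : Submodule F M} (φ : M →ₗ[F] N)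
    (hB : ∀ b ∈ B, φ b = 0) (hZ : ∀ y, ∃ z ∈ Z, φ z = y) :
    Module.finrank F N ≤ quotientDim Z B := by
  let ψ : Z →ₗ[F] N := φ.comp Z.subtype
  have hker : B.submoduleOf Z ≤ LinearMap.ker ψ := fun z hz => hB z hz
  refine LinearMap.finrank_le_finrank_of_surjective
    (f := (B.submoduleOf Z).liftQ ψ hker) fun y => ?_
  obtain ⟨z, hz, rfl⟩ := hZ y
  exact ⟨Submodule.Quotient.mk ⟨z, hz⟩, rfl⟩

end LinearAlgebra

/-! ### Betti numbers squeezed between counts of isolated hollow sets and crowded faces -/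

section HomologyBounds

variable {F V : Type*} [Field F] [LinearOrder V]

/-- The coefficient of a boundary at a nonempty set. -/
lemma boundary_apply [Fintype V] (z : Finset V →₀ F) {τ : Finset V} (hτ : τ.Nonempty) :
    boundary F V z τ = ∑ w ∈ τᶜ, (-1 : F) ^ (τ.filter (· < w)).card * z (insert w τ) := by
  induction z using Finsupp.induction_linear with
  | zero => simp
  | add f g hf hg => simp [hf, hg, mul_add, Finset.sum_add_distrib]
  | single s a =>
    have : boundary F V (Finsupp.single s a) τ = ∑ v ∈ s with (s.erase v).Nonempty,
        if s.erase v = τ then a * (-1 : F) ^ (s.filter (· < v)).card else 0 := by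
      simp [boundary, Finsupp.linearCombination_single, 
        Finsupp.single_apply, Finset.mul_sum]
    let g : V → F := fun v => if v ∈ s ∧ s.erase v = τ then a * (-1) ^ (s.filter (· < v)).card else 0
    have h1 : ∑ v ∈ s with (s.erase v).Nonempty,
        (if s.erase v = τ then a * (-1 : F) ^ (s.filter (· < v)).card else 0) = ∑ v, g v := by
      rw [Finset.sum_filter, ← Finset.sum_subset (Finset.subset_univ s)
        (f := g) (by intro v _ hv; simp [g, hv])]
      refine Finset.sum_congr rfl fun v hv => ?_
      by_cases h : s.erase v = τ
      · simp [g, h, hτ, hv]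
      · simp [g, h]
    rw [this, h1, ← Finset.sum_subset (Finset.subset_univ τᶜ) (f := g)]
    · refine Finset.sum_congr rfl fun w hw => ?_
      have hw' : w ∉ τ := by simpa using hw
      by_cases h : w ∈ s ∧ s.erase w = τ
      · obtain ⟨hws, rfl⟩ := h
        have : (s.erase w).filter (· < w) = s.filter (· < w) := by
          ext x; simp only [Finset.mem_filter, Finset.mem_erase]
          constructor
          · tauto
          · rintro ⟨h1, h2⟩; exact ⟨⟨h2.ne, h1⟩, h2⟩
        simp [g, hws, this, Finset.insert_erase hws, mul_comm]
      · simp only [g]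
        rw [if_neg h, Finsupp.single_apply, if_neg, mul_zero]
        rintro rfl
        exact h ⟨Finset.mem_insert_self _ _, Finset.erase_insert hw'⟩
    · intro w _ hw
      refine if_neg ?_
      rintro ⟨_, rfl⟩
      simp at hw

/-- A set is hollow if it is not a face but all its facets are. -/
def IsHollow (K : PreAbstractSimplicialComplex V) (T : Finset V) : Prop :=
  T ∉ K.faces ∧ ∀ v ∈ T, T.erase v ∈ K.faces

/-- A set of vertices is isolated if no edge leaves it. -/
def IsIsolated (K : PreAbstractSimplicialComplex V) (T : Finset V) : Prop :=
  ∀ v ∈ T, ∀ w ∉ T, ({v, w} : Finset V) ∉ K.faces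

variable {K : PreAbstractSimplicialComplex V} {S T σ : Finset V} {k : ℕ}

lemma pair_mem_faces {v w : V} (hT : T ∈ K.faces) (hv : v ∈ T) (hw : w ∈ T) :
    ({v, w} : Finset V) ∈ K.faces :=
  (K.isRelLowerSet_faces hT).2 (by simp [Finset.insert_subset_iff, hv, hw]) ⟨v, by simp⟩

lemma IsIsolated.subset_of_mem_faces (hT : IsIsolated K T) (hS : S ∈ K.faces) {v : V}
    (hvS : v ∈ S) (hvT : v ∈ T) : S ⊆ T := by
  intro w hw
  by_contra h
  exact hT v hvT w h (pair_mem_faces hS hvS hw)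

/-- With at least three vertices, any pair omits some vertex `u` and so lies in the facet `T.erase
u`. -/
lemma IsHollow.pair_mem_faces (hT : IsHollow K T) (hc : 3 ≤ T.card) {v w : V} (hv : v ∈ T)
    (hw : w ∈ T) : ({v, w} : Finset V) ∈ K.faces := by
  obtain ⟨u, hu, h⟩ : ∃ u ∈ T, u ∉ ({v, w} : Finset V) :=
    Finset.exists_mem_notMem_of_card_lt_card (Finset.card_le_two.trans_lt hc)
  simp only [Finset.mem_insert, Finset.mem_singleton, not_or] at h
  exact CechBetti.pair_mem_faces (hT.2 u hu) (by simp [hv, Ne.symm h.1]) (by simp [hw, Ne.symm h.2])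

lemma IsIsolated.subset_of_isHollow (hT : IsIsolated K T) (hS : IsHollow K S) (hc : 3 ≤ S.card)
    {v : V} (hvS : v ∈ S) (hvT : v ∈ T) : S ⊆ T := by
  intro w hw
  by_contra h
  exact hT v hvT w h (hS.pair_mem_faces hc hvS hw)

lemma cycle_apply_eq_zero {z : Finset V →₀ F} (hz : z ∈ cycles F K k) (hσ : σ ∉ K.faces) :
    z σ = 0 := by
  by_contra h
  exact hσ (hz.1 (Finsupp.mem_support_iff.2 h)).1

/-- In the boundary coefficient at `σ.erase v` only `σ` itself contributes: any other face over
`σ.erase v` would contain an edge leaving `σ`. -/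
lemma cycle_apply_isolated [Fintype V] {z : Finset V →₀ F} (hz : z ∈ cycles F K k)
    (hσ : IsIsolated K σ) (hc : 2 ≤ σ.card) : z σ = 0 := by
  obtain ⟨v, hv⟩ : σ.Nonempty := Finset.card_pos.1 (by omega)
  have hne : (σ.erase v).Nonempty := Finset.card_pos.1 (by rw [Finset.card_erase_of_mem hv]; omega)
  have h0 : boundary F V z (σ.erase v) = 0 := by
    rw [show boundary F V z = 0 from hz.2]; rfl
  rw [boundary_apply z hne, Finset.sum_eq_single v] at h0
  · simpa [Finset.insert_erase hv] using h0
  · intro w hw hwv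
    rw [cycle_apply_eq_zero hz, mul_zero]
    intro h
    obtain ⟨u, hu⟩ := hne
    have := hσ.subset_of_mem_faces h (Finset.mem_insert_of_mem hu) (Finset.mem_of_mem_erase hu)
      (Finset.mem_insert_self _ _)
    simp [hwv, this] at hw
  · simp

/-- Over the codimension-two set `(T.erase w).erase v` the only possible faces of the right size are
`T.erase v` and `T.erase w`, so the cycle condition ties their coefficients by a sign. A cycle on
the facets of an isolated set thus has one degree of freedom. -/
lemma cycle_apply_erase_eq_zero [Fintype V] {z : Finset V →₀ F} (hz : z ∈ cycles F K k)
    (hT : IsIsolated K T) (hc : 3 ≤ T.card) {v w : V} (hv : v ∈ T) (hw : w ∈ T)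
    (h0 : z (T.erase v) = 0) : z (T.erase w) = 0 := by
  rcases eq_or_ne v w with rfl | hvw
  · exact h0
  have hne : ((T.erase w).erase v).Nonempty := Finset.card_pos.1 (by
    rw [Finset.card_erase_of_mem (by simp [hvw, hv]), Finset.card_erase_of_mem hw]; omega)
  have hb : boundary F V z ((T.erase w).erase v) = 0 := by
    rw [show boundary F V z = 0 from hz.2]; rfl
  rw [boundary_apply z hne, Finset.sum_eq_single v] at hb
  · simpa [Finset.insert_erase (show v ∈ T.erase w by simp [hvw, hv])] using hb
  · intro u hu huv
    by_cases huw : u = w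
    · subst huw
      rw [Finset.erase_right_comm, Finset.insert_erase (by simp [hw, huv]), h0, mul_zero]
    rw [cycle_apply_eq_zero hz, mul_zero]
    intro h
    obtain ⟨x, hx⟩ := hne
    have := hT.subset_of_mem_faces h (Finset.mem_insert_of_mem hx)
      (Finset.mem_of_mem_erase (Finset.mem_of_mem_erase hx)) (Finset.mem_insert_self _ _)
    simp [huv, huw, this] at hu
  · simp

/-- The coefficients of the boundary of a single simplex. -/
lemma boundary_single_apply_erase [Fintype V] {v : V} (hv : v ∈ T) (hc : 2 ≤ T.card) :
    boundary F V (Finsupp.single T 1) (T.erase v) = (-1 : F) ^ ((T.erase v).filter (· < v)).card := by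
  have hne : (T.erase v).Nonempty := Finset.card_pos.1 (by rw [Finset.card_erase_of_mem hv]; omega)
  rw [boundary_apply _ hne, Finset.sum_eq_single v]
  · simp [Finset.insert_erase hv]
  · intro w hw hwv
    rw [Finsupp.single_apply, if_neg, mul_zero]
    intro h
    have hwT : w ∈ T := h ▸ Finset.mem_insert_self _ _
    simp [hwv, hwT] at hw
  · simp

lemma boundary_single_apply_of_not_subset [Fintype V] (hσ : σ.Nonempty) (h : ¬ σ ⊆ T) :
    boundary F V (Finsupp.single T 1) σ = 0 := by
  rw [boundary_apply _ hσ]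
  refine Finset.sum_eq_zero fun w _ => ?_
  rw [Finsupp.single_apply, if_neg, mul_zero]
  rintro rfl
  exact h (Finset.subset_insert _ _)

lemma boundary_single_mem_cycles [Fintype V] (hT : ∀ v ∈ T, T.erase v ∈ K.faces)
    (hc : T.card = k + 2) : boundary F V (Finsupp.single T 1) ∈ cycles F K k := by
  refine ⟨?_, boundary_boundary_single F V T⟩
  have h1 : boundary F V (Finsupp.single T 1) = ∑ v ∈ T with (T.erase v).Nonempty,
      Finsupp.single (T.erase v) ((-1 : F) ^ (T.filter (· < v)).card) := by
    simp [boundary, Finsupp.linearCombination_single]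
  rw [h1]
  refine Submodule.sum_mem _ fun v hv => ?_
  rw [Finset.mem_filter] at hv
  refine Finsupp.single_mem_supported F _ ⟨hT v hv.1, ?_⟩
  rw [Finset.card_erase_of_mem hv.1, hc]; rfl

/-- The isolated hollow sets with `m` elements. -/
def isolatedHollow [Fintype V] (K : PreAbstractSimplicialComplex V) (m : ℕ) : Finset (Finset V) :=
  open Classical in {T | T.card = m ∧ IsHollow K T ∧ IsIsolated K T}

lemma mem_isolatedHollow [Fintype V] {m : ℕ} :
    T ∈ isolatedHollow K m ↔ T.card = m ∧ IsHollow K T ∧ IsIsolated K T := by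
  simp [isolatedHollow]

lemma IsIsolated.eq_of_isHollow (hT : IsIsolated K T) (hS : IsHollow K S) (hc : 3 ≤ S.card)
    (hST : T.card = S.card) {v : V} (hvS : v ∈ S) (hvT : v ∈ T) : S = T :=
  Finset.eq_of_subset_of_card_le (hT.subset_of_isHollow hS hc hvS hvT) hST.le

/-- A facet of a simplex, chosen once and for all. -/
def facet (T : Finset V) : Finset V := if h : T.Nonempty then T.erase (T.min' h) else ∅

lemma exists_facet_eq (hT : T.Nonempty) : ∃ v ∈ T, facet T = T.erase v :=
  ⟨T.min' hT, T.min'_mem hT, by simp [facet, hT]⟩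

/-- Components that are boundaries of simplices contribute independent homology classes. -/
lemma card_isolatedHollow_le_betti [Fintype V] (hk : 1 ≤ k) :
    (isolatedHollow K (k + 2)).card ≤ betti F K k := by
  classical
  -- One facet coefficient per component detects its class: it vanishes on boundaries and is a sign
  -- on the cycle carried by the component.
  let φ : (Finset V →₀ F) →ₗ[F] (isolatedHollow K (k + 2) → F) :=
    LinearMap.pi fun T => Finsupp.lapply (facet T.1)
  -- A face with `k + 2` vertices over the chosen facet would be `T` itself, which is not a face.
  have key : ∀ T ∈ isolatedHollow K (k + 2), ∀ S : Finset V, facet T ⊆ S → S.card = k + 2 →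
      S ∈ K.faces → False := by
    intro T hT S hTS hS hSK
    obtain ⟨hc, hh, hi⟩ := mem_isolatedHollow.1 hT
    obtain ⟨v, hv, e⟩ := exists_facet_eq (T := T) (Finset.card_pos.1 (by omega))
    rw [e] at hTS
    obtain ⟨u, hu⟩ : (T.erase v).Nonempty :=
      Finset.card_pos.1 (by rw [Finset.card_erase_of_mem hv]; omega)
    have := hi.subset_of_mem_faces hSK (hTS hu) (Finset.mem_of_mem_erase hu)
    rw [Finset.eq_of_subset_of_card_le this (by omega)] at hSK
    exact hh.1 hSK
  have hne : ∀ T ∈ isolatedHollow K (k + 2), (facet T).Nonempty := by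
    intro T hT
    obtain ⟨hc, hh, hi⟩ := mem_isolatedHollow.1 hT
    obtain ⟨v, hv, e⟩ := exists_facet_eq (T := T) (Finset.card_pos.1 (by omega))
    rw [e]
    exact Finset.card_pos.1 (by rw [Finset.card_erase_of_mem hv]; omega)
  have h := finrank_le_quotientDim (Z := cycles F K k) (B := boundaries F K k) φ ?_ ?_
  · simpa [betti] using h
  · intro b hb
    ext T
    obtain ⟨c, hc, rfl⟩ := hb
    change boundary F V c (facet T.1) = 0
    rw [boundary_apply _ (hne T T.2)]
    refine Finset.sum_eq_zero fun w _ => ?_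
    by_cases h0 : c (insert w (facet T.1)) = 0
    · rw [h0, mul_zero]
    · have := hc (Finsupp.mem_support_iff.2 h0)
      exact (key T T.2 _ (Finset.subset_insert _ _) this.2 this.1).elim
  · intro y
    have hunit : ∀ T : isolatedHollow K (k + 2), ∃ a : F, a * boundary F V (Finsupp.single T.1 1)
        (facet T.1) = y T := by
      intro T
      obtain ⟨hc, hh, hi⟩ := mem_isolatedHollow.1 T.2
      obtain ⟨v, hv, e⟩ := exists_facet_eq (T := T.1) (Finset.card_pos.1 (by omega))
      refine ⟨y T * (boundary F V (Finsupp.single T.1 1) (facet T.1))⁻¹, ?_⟩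
      rw [inv_mul_cancel_right₀]
      rw [e, boundary_single_apply_erase hv (by omega)]
      exact pow_ne_zero _ (by simp)
    choose a ha using hunit
    refine ⟨∑ T, a T • boundary F V (Finsupp.single T.1 1), Submodule.sum_mem _ fun T _ =>
      Submodule.smul_mem _ _ ?_, ?_⟩
    · obtain ⟨hc, hh, -⟩ := mem_isolatedHollow.1 T.2
      exact boundary_single_mem_cycles hh.2 hc
    · ext T
      change (∑ S, a S • boundary F V (Finsupp.single S.1 1)) (facet T.1) = y T
      rw [Finsupp.finsetSum_apply, Finset.sum_eq_single T, Finsupp.smul_apply, smul_eq_mul, ha]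
      · intro S _ hST
        rw [Finsupp.smul_apply, boundary_single_apply_of_not_subset (hne T T.2), smul_zero]
        intro hsub
        obtain ⟨hc, hh, hi⟩ := mem_isolatedHollow.1 T.2
        obtain ⟨hc', hh', hi'⟩ := mem_isolatedHollow.1 S.2
        obtain ⟨v, hv, e⟩ := exists_facet_eq (T := T.1) (Finset.card_pos.1 (by omega))
        obtain ⟨u, hu⟩ := hne T T.2
        refine hST (Subtype.ext (hi.eq_of_isHollow hh' (by omega) (by omega) (hsub hu) ?_))
        rw [e] at hu
        exact Finset.mem_of_mem_erase hu
      · simp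

/-- The faces with `m` vertices that can be enlarged twice along edges. -/
def crowdedFaces [Fintype V] (K : PreAbstractSimplicialComplex V) (m : ℕ) : Finset (Finset V) :=
  open Classical in {σ | σ ∈ K.faces ∧ σ.card = m ∧ ∃ v ∉ σ, ∃ w ∉ insert v σ,
    (∃ u ∈ σ, ({u, v} : Finset V) ∈ K.faces) ∧ ∃ u ∈ insert v σ, ({u, w} : Finset V) ∈ K.faces}

lemma mem_crowdedFaces [Fintype V] {m : ℕ} :
    σ ∈ crowdedFaces K m ↔ σ ∈ K.faces ∧ σ.card = m ∧ ∃ v ∉ σ, ∃ w ∉ insert v σ,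
    (∃ u ∈ σ, ({u, v} : Finset V) ∈ K.faces) ∧
      ∃ u ∈ insert v σ, ({u, w} : Finset V) ∈ K.faces := by
  simp [crowdedFaces]

/-- A face is crowded, isolated, or a facet of an isolated set. -/
lemma face_trichotomy [Fintype V] (hσ : σ ∈ K.faces) (h : σ ∉ crowdedFaces K σ.card) :
    IsIsolated K σ ∨ ∃ v ∉ σ, IsIsolated K (insert v σ) := by
  by_contra! hcon
  obtain ⟨h1, h2⟩ := hcon
  simp only [IsIsolated, not_forall, not_not] at h1 h2
  obtain ⟨u, hu, v, hv, huv⟩ := h1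
  obtain ⟨u', hu', w, hw, huw⟩ := h2 v hv
  exact h (mem_crowdedFaces.2 ⟨hσ, rfl, v, hv, w, hw, ⟨u, hu, huv⟩, u', hu', huw⟩)

/-- Such a `T` would have to be `insert v σ`, and then the edge to `w` leaves it. Hence subtracting
boundaries of isolated simplices does not disturb coefficients at crowded faces. -/
lemma crowdedFaces_disjoint_isolated [Fintype V] {m : ℕ} (hσ : σ ∈ crowdedFaces K m)
    (hT : IsIsolated K T) (hc : T.card = m + 1) : ¬ σ ⊆ T := by
  intro hsub
  obtain ⟨-, hm, v, hv, w, hw, ⟨u, hu, huv⟩, u', hu', huw⟩ := mem_crowdedFaces.1 hσ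
  have hvT : v ∈ T := by
    by_contra h
    exact hT u (hsub hu) v h huv
  have : insert v σ = T := Finset.eq_of_subset_of_card_le
    (Finset.insert_subset_iff.2 ⟨hvT, hsub⟩) (by rw [Finset.card_insert_of_notMem hv]; omega)
  subst this
  exact hT u' hu' w hw huw

/-- The homology in degree `k` is carried by components that are boundaries of simplices and by
crowded faces. -/
lemma betti_le [Fintype V] (hk : 1 ≤ k) :
    betti F K k ≤ (isolatedHollow K (k + 2)).card + (crowdedFaces K (k + 1)).card := by
  classical
  let φ : (Finset V →₀ F) →ₗ[F] (isolatedHollow K (k + 2) → F) × (crowdedFaces K (k + 1) → F) :=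
    (LinearMap.pi fun T => Finsupp.lapply (facet T.1)).prod
      (LinearMap.pi fun σ => Finsupp.lapply σ.1)
  have h := quotientDim_le_finrank (Z := cycles F K k) (B := boundaries F K k) φ ?_
  · simpa [betti] using h
  intro z hz hφ
  have hz1 : ∀ T ∈ isolatedHollow K (k + 2), z (facet T) = 0 := fun T hT =>
    congrFun (congrArg Prod.fst hφ) ⟨T, hT⟩
  have hz2 : ∀ σ ∈ crowdedFaces K (k + 1), z σ = 0 := fun σ hσ =>
    congrFun (congrArg Prod.snd hφ) ⟨σ, hσ⟩
  let Q : Finset (Finset V) := {T | T.card = k + 2 ∧ T ∈ K.faces ∧ IsIsolated K T}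
  have hQ : ∀ T, T ∈ Q ↔ T.card = k + 2 ∧ T ∈ K.faces ∧ IsIsolated K T := by simp [Q]
  -- The boundary `b` matches `z` at one chosen facet of every isolated face with `k + 2` vertices.
  -- The goal is `z = b`.
  let b : Finset V →₀ F := ∑ T ∈ Q,
    (z (facet T) / boundary F V (Finsupp.single T 1) (facet T)) • boundary F V (Finsupp.single T 1)
  have hb : b ∈ boundaries F K k := Submodule.sum_mem _ fun T hT => Submodule.smul_mem _ _
    ⟨_, Finsupp.single_mem_supported F _ ⟨((hQ T).1 hT).2.1, ((hQ T).1 hT).1⟩, rfl⟩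
  have hy : z - b ∈ cycles F K k := Submodule.sub_mem _ hz (boundaries_le_cycles F K k hb)
  have hb_apply : ∀ T v, v ∈ T → IsIsolated K T → T.card = k + 2 → b (T.erase v) =
      if T ∈ Q then (z (facet T) / boundary F V (Finsupp.single T 1) (facet T)) *
        boundary F V (Finsupp.single T 1) (T.erase v) else 0 := by
    intro T v hv hi hc
    have hne : (T.erase v).Nonempty :=
      Finset.card_pos.1 (by rw [Finset.card_erase_of_mem hv]; omega)
    have : ∀ S ∈ Q, S ≠ T → (z (facet S) / boundary F V (Finsupp.single S 1) (facet S)) *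
        boundary F V (Finsupp.single S 1) (T.erase v) = 0 := by
      intro S hS hST
      rw [boundary_single_apply_of_not_subset hne, mul_zero]
      intro hsub
      obtain ⟨u, hu⟩ := hne
      refine hST (Finset.eq_of_subset_of_card_le (hi.subset_of_mem_faces ((hQ S).1 hS).2.1 (hsub hu)
        (Finset.mem_of_mem_erase hu)) ?_)
      rw [hc, ((hQ S).1 hS).1]
    simp only [b, Finsupp.finsetSum_apply, Finsupp.smul_apply, smul_eq_mul]
    split_ifs with hTQ
    · exact Finset.sum_eq_single_of_mem T hTQ this
    · exact Finset.sum_eq_zero fun S hS => this S hS fun h => hTQ (h ▸ hS)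
  have : z = b := by
    rw [← sub_eq_zero]
    ext σ
    by_contra hne
    obtain ⟨hσK, hσc⟩ := hy.1 (Finsupp.mem_support_iff.2 hne)
    by_cases hbad : σ ∈ crowdedFaces K (k + 1)
    · refine hne ?_
      rw [Finsupp.sub_apply, hz2 σ hbad, zero_sub, Finsupp.coe_zero, Pi.zero_apply, neg_eq_zero,
        Finsupp.finsetSum_apply]
      refine Finset.sum_eq_zero fun T hT => ?_
      rw [Finsupp.smul_apply, boundary_single_apply_of_not_subset
        (Finset.card_pos.1 (by omega)) (crowdedFaces_disjoint_isolated hbad ((hQ T).1 hT).2.2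
        ((hQ T).1 hT).1), smul_zero]
    · rw [← hσc] at hbad
      rcases face_trichotomy hσK hbad with hi | ⟨v, hv, hi⟩
      · exact hne (cycle_apply_isolated hy hi (by omega))
      · have hc : (insert v σ).card = k + 2 := by rw [Finset.card_insert_of_notMem hv]; omega
        have hσe : σ = (insert v σ).erase v := (Finset.erase_insert hv).symm
        obtain ⟨u, hu, hf⟩ := exists_facet_eq (T := insert v σ) (Finset.insert_nonempty _ _)
        suffices ∃ w ∈ insert v σ, (z - b) ((insert v σ).erase w) = 0 by
          obtain ⟨w, hw, h0⟩ := this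
          have := cycle_apply_erase_eq_zero hy hi (by omega) hw (Finset.mem_insert_self v σ) h0
          rw [← hσe] at this
          exact hne this
        -- One vanishing facet coefficient suffices. If the isolated set is a face, `b` was chosen
        -- to cancel it; if hollow, `φ` records it; otherwise some facet is missing from `K`.
        by_cases hTK : insert v σ ∈ K.faces
        · refine ⟨u, hu, ?_⟩
          rw [Finsupp.sub_apply, hb_apply _ _ hu hi hc, if_pos ((hQ _).2 ⟨hc, hTK, hi⟩), ← hf,
            div_mul_cancel₀, sub_self]
          rw [hf, boundary_single_apply_erase hu (by omega)]
          exact pow_ne_zero _ (by simp)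
        · by_cases hh : ∀ w ∈ insert v σ, (insert v σ).erase w ∈ K.faces
          · refine ⟨u, hu, ?_⟩
            rw [Finsupp.sub_apply, hb_apply _ _ hu hi hc, if_neg fun h => hTK ((hQ _).1 h).2.1,
              ← hf, hz1 _ (mem_isolatedHollow.2 ⟨hc, ⟨hTK, hh⟩, hi⟩), sub_zero]
          · push Not at hh
            obtain ⟨w, hw, hw'⟩ := hh
            refine ⟨w, hw, ?_⟩
            exact cycle_apply_eq_zero hy hw'
  rw [this]
  exact hb

end HomologyBounds

/-! ### Simplex-boundary components as isolated hollow sets -/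

section Counting

variable {V : Type*} [LinearOrder V] {K : PreAbstractSimplicialComplex V} {T : Finset V} {m : ℕ}

lemma singleton_mem_simplexBoundary (hm : 1 ≤ m) (w : Fin (m + 1)) :
    ({w} : Finset (Fin (m + 1))) ∈ (simplexBoundary m).faces := by
  refine ⟨Finset.singleton_nonempty w, fun h => ?_⟩
  have := congrArg Finset.card h
  simp at this
  omega

/-- Being the boundary of a simplex is being hollow of the right size. -/
lemma isomorphic_simplexBoundary_iff (hV : ∀ v, ({v} : Finset V) ∈ K.faces) (hm : 1 ≤ m) :
    Isomorphic (inducedSubcomplex K (T : Set V)) (simplexBoundary m) ↔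
      T.card = m + 1 ∧ IsHollow K T := by
  classical
  have hvert : ∀ v, ({v} : Finset V) ∈ (inducedSubcomplex K (T : Set V)).faces ↔ v ∈ T := by
    intro v
    refine ⟨fun h => by simpa using h.2, fun h => ⟨hV v, by simpa using h⟩⟩
  have hw := singleton_mem_simplexBoundary hm
  let e₁ : {v : V // ({v} : Finset V) ∈ (inducedSubcomplex K (T : Set V)).faces} ≃ T :=
    Equiv.subtypeEquivRight hvert
  let e₂ : {w : Fin (m + 1) // ({w} : Finset (Fin (m + 1))) ∈ (simplexBoundary m).faces} ≃
    Fin (m + 1) := Equiv.subtypeUnivEquiv hw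
  -- Membership in the simplex boundary depends only on cardinality, so any bijection of vertices
  -- serves as an isomorphism.
  have hcard₂ : ∀ s : Finset
      {w : Fin (m + 1) // ({w} : Finset (Fin (m + 1))) ∈ (simplexBoundary m).faces},
      s.map (Function.Embedding.subtype _) ∈ (simplexBoundary m).faces ↔
        s.Nonempty ∧ s.card ≠ m + 1 := by
    intro s
    change (s.map (Function.Embedding.subtype _)).Nonempty ∧
      s.map (Function.Embedding.subtype _) ≠ Finset.univ ↔ _
    rw [Finset.map_nonempty, ne_eq, ← Finset.card_eq_iff_eq_univ, Finset.card_map, Fintype.card_fin]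
  have hface : ∀ s : Finset {v : V // ({v} : Finset V) ∈ (inducedSubcomplex K (T : Set V)).faces},
      s.map (Function.Embedding.subtype _) ∈ (inducedSubcomplex K (T : Set V)).faces ↔
        s.map (Function.Embedding.subtype _) ∈ K.faces := by
    intro s
    refine ⟨fun h => h.1, fun h => ⟨h, ?_⟩⟩
    intro v hv
    simp only [Finset.coe_map, Set.mem_image] at hv
    obtain ⟨x, -, rfl⟩ := hv
    exact (hvert _).1 x.2
  have hsub : ∀ S ⊆ T, ∃ s : Finset
      {v : V // ({v} : Finset V) ∈ (inducedSubcomplex K (T : Set V)).faces},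
      s.map (Function.Embedding.subtype _) = S ∧ s.card = S.card := by
    intro S hS
    have : (S.subtype fun v => ({v} : Finset V) ∈
        (inducedSubcomplex K (T : Set V)).faces).map (Function.Embedding.subtype _) = S :=
      Finset.subtype_map_of_mem fun v hv => (hvert v).2 (hS hv)
    exact ⟨_, this, by rw [← Finset.card_map, this]⟩
  constructor
  · rintro ⟨e, he⟩
    have hc : T.card = m + 1 := by
      have := Fintype.card_congr (e₁.symm.trans (e.trans e₂))
      simpa using this
    simp only [hcard₂, hface, Finset.map_nonempty, Finset.card_map] at he
    refine ⟨hc, fun hT => ?_, fun v hv => ?_⟩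
    · obtain ⟨s, hs, hsc⟩ := hsub T subset_rfl
      exact ((he s).1 (by rwa [hs])).2 (by omega)
    · obtain ⟨s, hs, hsc⟩ := hsub (T.erase v) (Finset.erase_subset _ _)
      rw [Finset.card_erase_of_mem hv] at hsc
      rw [← hs]
      exact (he s).2 ⟨Finset.card_pos.1 (by omega), by omega⟩
  · rintro ⟨hc, hT, hT'⟩
    refine ⟨e₁.trans ((T.equivFinOfCardEq hc).trans e₂.symm), fun s => ?_⟩
    rw [hcard₂, hface, Finset.map_nonempty, Finset.card_map]
    have hsT : s.map (Function.Embedding.subtype _) ⊆ T := by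
      intro v hv
      simp only [Finset.mem_map] at hv
      obtain ⟨x, -, rfl⟩ := hv
      exact (hvert _).1 x.2
    constructor
    · intro h
      refine ⟨Finset.map_nonempty.1 (K.isRelLowerSet_faces h).1, fun hs => hT ?_⟩
      rwa [Finset.eq_of_subset_of_card_le hsT (by rw [Finset.card_map]; omega)] at h
    · rintro ⟨hs, hs'⟩
      have hne : s.map (Function.Embedding.subtype _) ≠ T := by
        intro h
        rw [← h, Finset.card_map] at hc
        exact hs' hc
      obtain ⟨v, hv, hvs⟩ := Finset.exists_of_ssubset (hsT.ssubset_of_ne hne)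
      exact (K.isRelLowerSet_faces (hT' v hv)).2 (Finset.subset_erase.2 ⟨hsT, hvs⟩)
        (Finset.map_nonempty.2 hs)

lemma isIsolated_supp [Fintype V] (c : (edgeGraph K).ConnectedComponent) (h : ∀ v, v ∈ T ↔ v ∈ c.supp) :
    IsIsolated K T := by
  intro v hv w hw hvw
  have hne : v ≠ w := fun e => hw (e ▸ hv)
  rw [h] at hv hw
  rw [SimpleGraph.ConnectedComponent.mem_supp_iff] at hv hw
  refine hw (hv ▸ (SimpleGraph.ConnectedComponent.eq.2 ?_))
  exact (SimpleGraph.Adj.reachable (show (edgeGraph K).Adj v w from ⟨hne, hvw⟩)).symm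

/-- Components that are boundaries of simplices are isolated hollow sets. -/
lemma simplexBoundaryComponents_eq [Fintype V] (hV : ∀ v, ({v} : Finset V) ∈ K.faces) (hm : 2 ≤ m) :
    simplexBoundaryComponents K m = (isolatedHollow K (m + 1)).card := by
  classical
  rw [simplexBoundaryComponents, ← Set.ncard_coe_finset]
  have hiff : ∀ c : (edgeGraph K).ConnectedComponent,
      Isomorphic (inducedSubcomplex K c.supp) (simplexBoundary m) ↔
        c.supp.toFinset.card = m + 1 ∧ IsHollow K c.supp.toFinset := by
    intro c
    rw [← isomorphic_simplexBoundary_iff hV (by omega), Set.coe_toFinset]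
  refine Set.ncard_congr (fun c _ => c.supp.toFinset) ?_ ?_ ?_
  · intro c hc
    obtain ⟨h1, h2⟩ := (hiff c).1 hc
    exact mem_isolatedHollow.2 ⟨h1, h2, isIsolated_supp c (by simp)⟩
  · intro c c' _ _ h
    exact SimpleGraph.ConnectedComponent.supp_injective (Set.toFinset_inj.1 h)
  · intro T hT
    obtain ⟨hc, hh, hi⟩ := mem_isolatedHollow.1 hT
    obtain ⟨v, hv⟩ : T.Nonempty := Finset.card_pos.1 (by omega)
    have hsupp : ((edgeGraph K).connectedComponentMk v).supp.toFinset = T := by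
      ext w
      rw [Set.mem_toFinset, SimpleGraph.ConnectedComponent.mem_supp_iff,
        SimpleGraph.ConnectedComponent.eq]
      constructor
      · rintro ⟨p⟩
        induction p with
        | nil => exact hv
        | cons hadj p ih =>
          by_contra hw
          exact hi _ (ih hv) _ hw (by rw [Finset.pair_comm]; exact hadj.2)
      · intro hw
        by_cases hne : w = v
        · rw [hne]
        -- Connectedness of `T` uses `m + 1 ≥ 3`: two non-adjacent vertices would be hollow but
        -- disconnected.
        · exact SimpleGraph.Adj.reachable
            (show (edgeGraph K).Adj w v from ⟨hne, hh.pair_mem_faces (by omega) hw hv⟩)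
    exact ⟨_, (hiff _).2 (by rw [hsupp]; exact ⟨hc, hh⟩), hsupp⟩

end Counting

/-! ### Error terms bounded by counts of close points -/

section Cech

lemma card_le_two_pow_mul {V : Type*} {A B : Finset (Finset V)} {m : ℕ} (hB : ∀ U ∈ B, U.card = m)
    (h : ∀ S ∈ A, ∃ U ∈ B, S ⊆ U) : A.card ≤ 2 ^ m * B.card := by
  classical
  have : A ⊆ B.biUnion Finset.powerset := by
    intro S hS
    obtain ⟨U, hU, hSU⟩ := h S hS
    exact Finset.mem_biUnion.2 ⟨U, hU, Finset.mem_powerset.2 hSU⟩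
  refine (Finset.card_le_card this).trans ?_
  rw [mul_comm]
  exact Finset.card_biUnion_le_card_mul _ _ _ fun U hU => by rw [Finset.card_powerset, hB U hU]

section Distances

variable {V E : Type*} [PseudoMetricSpace E] {x : V → E} {r : ℝ}

lemma dist_le_of_mem_cechComplex {σ : Finset V} (hσ : σ ∈ (cechComplex x r).faces) {i j : V}
    (hi : i ∈ σ) (hj : j ∈ σ) : dist (x i) (x j) ≤ r := by
  obtain ⟨-, c, hc⟩ := hσ
  simp only [Set.mem_iInter, Metric.mem_closedBall'] at hc
  have h1 := hc i hi
  have h2 := hc j hj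
  rw [dist_comm] at h1
  linarith [dist_triangle_left (x i) (x j) c, dist_comm c (x j), dist_comm c (x i)]

lemma singleton_mem_cechComplex (hr : 0 ≤ r) (v : V) : ({v} : Finset V) ∈ (cechComplex x r).faces :=
  ⟨Finset.singleton_nonempty v, x v, by simp; positivity⟩

/-- Attaching a vertex along an edge costs at most `r` in diameter. Two attachments to a face
account for the radius `3 * r` below. -/
lemma dist_le_insert [DecidableEq V] {σ : Finset V} {a : ℝ} (ha : 0 ≤ a) (hr : 0 ≤ r)
    (hσ : ∀ i ∈ σ, ∀ j ∈ σ, dist (x i) (x j) ≤ a) {u v : V} (hu : u ∈ σ)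
    (huv : ({u, v} : Finset V) ∈ (cechComplex x r).faces) :
    ∀ i ∈ insert v σ, ∀ j ∈ insert v σ, dist (x i) (x j) ≤ a + r := by
  have h : dist (x u) (x v) ≤ r := dist_le_of_mem_cechComplex huv (by simp) (by simp)
  have h' : ∀ i ∈ σ, dist (x i) (x v) ≤ a + r := fun i hi =>
    (dist_triangle _ (x u) _).trans (add_le_add (hσ i hi u hu) h)
  intro i hi j hj
  rcases Finset.mem_insert.1 hi with rfl | hi' <;>
    rcases Finset.mem_insert.1 hj with rfl | hj'
  · rw [dist_self]; positivity
  · rw [dist_comm]; exact h' j hj'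
  · exact h' i hi'
  · exact (hσ i hi' j hj').trans (by linarith)

end Distances

variable {V E : Type*} [LinearOrder V] [Fintype V] [PseudoMetricSpace E] {x : V → E} {r : ℝ}

/-- The sets of `m` labels whose points have mutual distances at most `R`. -/
def closeSets (x : V → E) (R : ℝ) (m : ℕ) : Finset (Finset V) :=
  open Classical in {U | U.card = m ∧ ∀ i ∈ U, ∀ j ∈ U, dist (x i) (x j) ≤ R}

lemma mem_closeSets {U : Finset V} {R : ℝ} {m : ℕ} :
    U ∈ closeSets x R m ↔ U.card = m ∧ ∀ i ∈ U, ∀ j ∈ U, dist (x i) (x j) ≤ R := by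
  simp [closeSets]

/-- The hollow sets with `m` elements. -/
def hollowSets (K : PreAbstractSimplicialComplex V) (m : ℕ) : Finset (Finset V) :=
  open Classical in {T | T.card = m ∧ IsHollow K T}

lemma mem_hollowSets {K : PreAbstractSimplicialComplex V} {T : Finset V} {m : ℕ} :
    T ∈ hollowSets K m ↔ T.card = m ∧ IsHollow K T := by
  simp [hollowSets]

lemma card_crowdedFaces_cechComplex_le (hr : 0 ≤ r) (m : ℕ) :
    (crowdedFaces (cechComplex x r) m).card ≤
      2 ^ (m + 2) * (closeSets x (3 * r) (m + 2)).card := by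
  refine card_le_two_pow_mul (fun U hU => (mem_closeSets.1 hU).1) fun σ hσ => ?_
  obtain ⟨hσ, hm, v, hv, w, hw, ⟨u, hu, huv⟩, u', hu', huw⟩ := mem_crowdedFaces.1 hσ
  refine ⟨insert w (insert v σ), mem_closeSets.2 ⟨?_, ?_⟩,
    (Finset.subset_insert _ _).trans (Finset.subset_insert _ _)⟩
  · rw [Finset.card_insert_of_notMem hw, Finset.card_insert_of_notMem hv, hm]
  · have h1 := dist_le_insert (x := x) hr hr
      (fun i hi j hj => dist_le_of_mem_cechComplex hσ hi hj) hu huv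
    have h2 := dist_le_insert (by positivity) hr h1 hu' huw
    intro i hi j hj
    linarith [h2 i hi j hj]

/-- A non-isolated hollow set together with the end of a leaving edge has diameter at most `2 * r`;
the weaker `3 * r` matches the bound for crowded faces. -/
lemma card_hollowSets_cechComplex_le (hr : 0 ≤ r) {m : ℕ} (hm : 3 ≤ m) :
    (hollowSets (cechComplex x r) m).card ≤ (isolatedHollow (cechComplex x r) m).card +
      2 ^ (m + 1) * (closeSets x (3 * r) (m + 1)).card := by
  classical
  have h1 : (hollowSets (cechComplex x r) m \ isolatedHollow (cechComplex x r) m).card ≤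
      2 ^ (m + 1) * (closeSets x (3 * r) (m + 1)).card := by
    refine card_le_two_pow_mul (fun U hU => (mem_closeSets.1 hU).1) fun T hT => ?_
    rw [Finset.mem_sdiff, mem_hollowSets, mem_isolatedHollow] at hT
    obtain ⟨⟨hc, hh⟩, hi⟩ := hT
    have hi : ¬ IsIsolated (cechComplex x r) T := fun h => hi ⟨hc, hh, h⟩
    simp only [IsIsolated, not_forall, not_not] at hi
    obtain ⟨u, hu, w, hw, huw⟩ := hi
    refine ⟨insert w T, mem_closeSets.2 ⟨by rw [Finset.card_insert_of_notMem hw, hc], ?_⟩,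
      Finset.subset_insert _ _⟩
    have h2 := dist_le_insert (x := x) hr hr (fun i hi j hj => dist_le_of_mem_cechComplex
      (hh.pair_mem_faces (by omega) hi hj) (by simp) (by simp)) hu huw
    intro i hi j hj
    linarith [h2 i hi j hj]
  have h2 : isolatedHollow (cechComplex x r) m ⊆ hollowSets (cechComplex x r) m := fun T hT =>
    mem_hollowSets.2 ⟨(mem_isolatedHollow.1 hT).1, (mem_isolatedHollow.1 hT).2.1⟩
  have h3 := Finset.card_sdiff_add_card_eq_card h2
  omega

lemma card_isolatedHollow_le (K : PreAbstractSimplicialComplex V) (m : ℕ) :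
    (isolatedHollow K m).card ≤ (hollowSets K m).card :=
  Finset.card_le_card fun _ hT =>
    mem_hollowSets.2 ⟨(mem_isolatedHollow.1 hT).1, (mem_isolatedHollow.1 hT).2.1⟩

end Cech

/-! ### Similarity invariance, measurability, and a stable hollow simplex -/

section Geometry

lemma mem_cechComplex_iff {ι E : Type*} [PseudoMetricSpace E] {x : ι → E} {r : ℝ} {σ : Finset ι} :
    σ ∈ (cechComplex x r).faces ↔ σ.Nonempty ∧ ∃ c, ∀ i ∈ σ, dist (x i) c ≤ r / 2 := by
  change σ.Nonempty ∧ (⋂ i ∈ σ, Metric.closedBall (x i) (r / 2)).Nonempty ↔ _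
  simp [Set.Nonempty, dist_comm]

/-- The Čech complex of a reindexed family. -/
lemma map_mem_cechComplex_iff {ι κ E : Type*} [PseudoMetricSpace E] {x : ι → E} {r : ℝ}
    (e : κ ↪ ι) (σ : Finset κ) :
    σ.map e ∈ (cechComplex x r).faces ↔ σ ∈ (cechComplex (x ∘ e) r).faces := by
  simp [mem_cechComplex_iff]

lemma isHollow_map_cechComplex_iff {ι κ E : Type*} [LinearOrder ι] [LinearOrder κ]
    [PseudoMetricSpace E] {x : ι → E} {r : ℝ} (e : κ ↪ ι) (σ : Finset κ) :
    IsHollow (cechComplex x r) (σ.map e) ↔ IsHollow (cechComplex (x ∘ e) r) σ := by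
  simp only [IsHollow, map_mem_cechComplex_iff, Finset.forall_mem_map, ← Finset.map_erase]

lemma cechComplex_add_smul {ι E : Type*} [NormedAddCommGroup E] [NormedSpace ℝ E] (x : ι → E)
    (a : E) {r : ℝ} (hr : 0 < r) : cechComplex (fun i => a + r • x i) r = cechComplex x 1 := by
  ext σ
  rw [mem_cechComplex_iff, mem_cechComplex_iff]
  refine and_congr_right fun _ => ⟨?_, ?_⟩
  · rintro ⟨c, hc⟩
    refine ⟨r⁻¹ • (c - a), fun i hi => ?_⟩
    have h : (a + r • x i) - c = r • (x i - r⁻¹ • (c - a)) := by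
      rw [smul_sub, smul_inv_smul₀ hr.ne']; abel
    have := hc i hi
    rw [dist_eq_norm, h, norm_smul, Real.norm_of_nonneg hr.le] at this
    rw [dist_eq_norm]
    nlinarith
  · rintro ⟨c, hc⟩
    refine ⟨a + r • c, fun i hi => ?_⟩
    have := hc i hi
    rw [dist_add_left, dist_smul₀, Real.norm_of_nonneg hr.le]
    nlinarith

/-- The common points of the balls stay bounded along a convergent sequence of configurations, so in
a proper space a subsequence converges to a common point for the limit. -/
lemma isClosed_setOf_mem_cechComplex {ι E : Type*} [Finite ι] [PseudoMetricSpace E] [ProperSpace E]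
    (σ : Finset ι) (r : ℝ) : IsClosed {x : ι → E | σ ∈ (cechComplex x r).faces} := by
  rcases σ.eq_empty_or_nonempty with rfl | hσ
  · simp [mem_cechComplex_iff]
  refine IsSeqClosed.isClosed fun u x hu hx => ?_
  simp only [mem_cechComplex_iff, hσ, true_and, Set.mem_ofPred_eq] at hu ⊢
  choose c hc using hu
  obtain ⟨i, hi⟩ := hσ
  have hx' : ∀ j, Tendsto (fun n => u n j) atTop (𝓝 (x j)) := tendsto_pi_nhds.1 hx
  obtain ⟨C, hC⟩ := (Metric.isBounded_range_of_tendsto _ (hx' i)).subset_closedBall (x i)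
  obtain ⟨a, -, φ, hφ, ha⟩ := tendsto_subseq_of_bounded (x := c)
    (s := Metric.closedBall (x i) (r / 2 + C)) Metric.isBounded_closedBall fun n => by
      have h1 := hc n i hi
      have h2 : dist (u n i) (x i) ≤ C := hC ⟨n, rfl⟩
      rw [Metric.mem_closedBall]
      linarith [dist_triangle_left (c n) (x i) (u n i)]
  refine ⟨a, fun j hj => ?_⟩
  exact le_of_tendsto' (((hx' j).comp hφ.tendsto_atTop).dist ha) fun n => hc (φ n) j hj

lemma measurableSet_setOf_isHollow {ι E : Type*} [Finite ι] [LinearOrder ι] [PseudoMetricSpace E]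
    [ProperSpace E] [SecondCountableTopology E] [MeasurableSpace E] [BorelSpace E]
    (T : Finset ι) (r : ℝ) :
    MeasurableSet {x : ι → E | IsHollow (cechComplex x r) T} := by
  have h : ∀ σ : Finset ι, MeasurableSet {x : ι → E | σ ∈ (cechComplex x r).faces} := fun σ =>
    (isClosed_setOf_mem_cechComplex σ r).measurableSet
  simp only [IsHollow, Set.ofPred_and, Set.ofPred_forall]
  exact (h T).compl.inter (MeasurableSet.iInter fun v => MeasurableSet.iInter fun _ => h _)

variable {E : Type*} [NormedAddCommGroup E] [InnerProductSpace ℝ E]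

/-- Unit vectors with the origin in their convex hull, any proper subfamily of which
lies in an open half space, form a hollow simplex, stably under perturbation after rescaling. -/
lemma exists_stable_hollow {ι : Type*} [Fintype ι] [LinearOrder ι] [Nontrivial ι] (x : ι → E)
    (hx : ∀ i, ‖x i‖ = 1) (w : ι → ℝ) (hw : ∀ i, 0 ≤ w i) (hw1 : 0 < ∑ i, w i)
    (hwx : ∑ i, w i • x i = 0) (hu : ∀ j, ∃ u : E, ∀ i, i ≠ j → 0 < inner ℝ (x i) u) :
    ∃ x' : ι → E, ∃ δ > 0, ∀ y : ι → E, (∀ i, dist (y i) (x' i) ≤ δ) →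
      IsHollow (cechComplex y 1) Finset.univ := by
  -- Moving the centre slightly from the origin towards `u` brings all points but the `j`-th
  -- strictly within distance `1`.
  have h1 : ∀ j, ∃ c : E, ∀ i, i ≠ j → ‖x i - c‖ < 1 := by
    intro j
    obtain ⟨u, hu⟩ := hu j
    have hev : ∀ᶠ t in 𝓝[>] (0 : ℝ), ∀ i, i ≠ j → ‖x i - t • u‖ < 1 := by
      refine eventually_all.2 fun i => ?_
      by_cases hij : i = j
      · simp [hij]
      have hc : Tendsto (fun t : ℝ => 2 * inner ℝ (x i) u - t * ‖u‖ ^ 2) (𝓝[>] 0)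
          (𝓝 (2 * inner ℝ (x i) u - 0 * ‖u‖ ^ 2)) :=
        ((by fun_prop : Continuous fun t : ℝ => 2 * inner ℝ (x i) u - t * ‖u‖ ^ 2).tendsto
          0).mono_left nhdsWithin_le_nhds
      have hpos : 0 < 2 * inner ℝ (x i) u - 0 * ‖u‖ ^ 2 := by linarith [hu i hij]
      filter_upwards [hc.eventually_const_lt hpos, self_mem_nhdsWithin] with t ht ht0 _
      have ht0 : 0 < t := ht0
      have hsq : ‖x i - t • u‖ ^ 2 < 1 := by
        rw [norm_sub_sq_real, hx, inner_smul_right, norm_smul, Real.norm_of_nonneg ht0.le]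
        nlinarith
      nlinarith [norm_nonneg (x i - t • u)]
    obtain ⟨t, ht⟩ := hev.exists
    exact ⟨t • u, ht⟩
  choose c hc using h1
  -- The weighted mean of `‖x i - b‖ ^ 2` equals `1 + ‖b‖ ^ 2`, so no centre is strictly within
  -- distance `1` of all the points.
  have h2 : ∀ b : E, ∃ i, 1 ≤ ‖x i - b‖ := by
    intro b
    by_contra! hb
    have hsum : ∑ i, w i * (‖x i - b‖ ^ 2) = (∑ i, w i) * (1 + ‖b‖ ^ 2) := by
      have : ∀ i, w i * (‖x i - b‖ ^ 2) = w i * (1 + ‖b‖ ^ 2) - 2 * inner ℝ (w i • x i) b := by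
        intro i
        rw [norm_sub_sq_real, hx, real_inner_smul_left]
        ring
      simp only [this, Finset.sum_sub_distrib, ← Finset.mul_sum, ← Finset.sum_mul, ← sum_inner, hwx,
        inner_zero_left, mul_zero, sub_zero]
    have hle : ∑ i, w i * (‖x i - b‖ ^ 2) < ∑ i, w i := by
      obtain ⟨i, -, hi⟩ := Finset.exists_lt_of_sum_lt (s := Finset.univ) (f := fun _ => (0 : ℝ))
        (g := w) (by simpa using hw1)
      have hsq : ∀ i, ‖x i - b‖ ^ 2 < 1 := fun i => by
        nlinarith [norm_nonneg (x i - b), hb i]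
      refine Finset.sum_lt_sum (fun i _ => ?_) ⟨i, Finset.mem_univ i, ?_⟩
      · nlinarith [hsq i, hw i]
      · nlinarith [hsq i]
    nlinarith [sq_nonneg ‖b‖]
  obtain ⟨s, hs, hs1, hs0⟩ : ∃ s : ℝ, (∀ i j, i ≠ j → ‖x i - c j‖ < s) ∧ s < 1 ∧ 0 < s := by
    have hev : ∀ᶠ s in 𝓝[<] (1 : ℝ), ∀ i j, i ≠ j → ‖x i - c j‖ < s := by
      refine eventually_all.2 fun i => eventually_all.2 fun j => ?_
      by_cases hij : i = j
      · simp [hij]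
      filter_upwards [mem_nhdsWithin_of_mem_nhds (lt_mem_nhds (hc j i hij))] with s hs _ using hs
    have hlt : ∀ᶠ s in 𝓝[<] (1 : ℝ), s < 1 := self_mem_nhdsWithin
    have hgt : ∀ᶠ s in 𝓝[<] (1 : ℝ), 0 < s :=
      mem_nhdsWithin_of_mem_nhds (lt_mem_nhds zero_lt_one)
    obtain ⟨s, h, h', h''⟩ := (hev.and (hlt.and hgt)).exists
    exact ⟨s, h, h', h''⟩
  -- This scale puts the radius `1 / 2` midway between `l * s` and `l`; the perturbation `l * (1 -
  -- s) / 4` is half the margin on either side.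
  let l : ℝ := (1 + s)⁻¹
  have hl : l * (1 + s) = 1 := inv_mul_cancel₀ (by positivity)
  have hl0 : 0 < l := by positivity
  refine ⟨fun i => l • x i, l * (1 - s) / 4, by nlinarith, fun y hy => ⟨?_, fun j _ => ?_⟩⟩
  · rw [mem_cechComplex_iff]
    rintro ⟨-, b, hb⟩
    obtain ⟨i, hi⟩ := h2 (l⁻¹ • b)
    have h3 : l ≤ dist (l • x i) b := by
      have : l • x i - b = l • (x i - l⁻¹ • b) := by rw [smul_sub, smul_inv_smul₀ hl0.ne']
      rw [dist_eq_norm, this, norm_smul, Real.norm_of_nonneg hl0.le]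
      nlinarith
    have h4 := hb i (Finset.mem_univ i)
    have h5 := hy i
    have h6 := dist_triangle_left (l • x i) b (y i)
    nlinarith
  · rw [mem_cechComplex_iff]
    obtain ⟨i, hi⟩ := exists_ne j
    refine ⟨⟨i, by simp [hi]⟩, l • c j, fun i hi => ?_⟩
    have h3 := hs i j (by simpa using hi)
    have h4 : dist (l • x i) (l • c j) ≤ l * s := by
      rw [dist_smul₀, Real.norm_of_nonneg hl0.le, dist_eq_norm]
      gcongr
    have h5 := hy i
    have h6 := dist_triangle (y i) (l • x i) (l • c j)
    nlinarith

/-- A space with `m` orthonormal vectors contains a stable hollow `m`-simplex. -/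
lemma exists_stable_hollow_of_orthonormal {m : ℕ} (hm : 1 ≤ m) {v : Fin m → E}
    (hv : Orthonormal ℝ v) :
    ∃ x' : Fin (m + 1) → E, ∃ δ > 0, ∀ y : Fin (m + 1) → E, (∀ i, dist (y i) (x' i) ≤ δ) →
      IsHollow (cechComplex y 1) Finset.univ := by
  have : Nontrivial (Fin (m + 1)) := Fin.nontrivial_iff_two_le.2 (by omega)
  have hm0 : (0 : ℝ) < m := by exact_mod_cast hm
  let a : ℝ := (√m)⁻¹
  have ha : 0 < a := by positivity
  have hinner : ∀ (i : Fin m) (g : Fin m → ℝ), inner ℝ (v i) (∑ j, g j • v j) = g i := fun i g =>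
    hv.inner_right_fintype g i
  refine exists_stable_hollow (Fin.cons (-(a • ∑ j, v j)) v) ?_ (Fin.cons 1 fun _ => a) ?_ ?_ ?_ ?_
  · intro i
    refine Fin.cases ?_ (fun i => ?_) i
    · have : ‖∑ j, v j‖ ^ 2 = m := by
        rw [← real_inner_self_eq_norm_sq, sum_inner]
        have := fun i => hinner i fun _ => 1
        simp only [one_smul] at this
        simp [this]
      rw [Fin.cons_zero, norm_neg, norm_smul, Real.norm_of_nonneg ha.le,
        ← Real.sqrt_sq (norm_nonneg (∑ j, v j)), this]
      exact inv_mul_cancel₀ (by positivity)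
    · simpa using hv.1 i
  · intro i
    refine Fin.cases ?_ (fun i => ?_) i <;> simp [ha.le]
  · rw [Fin.sum_univ_succ]
    simp only [Fin.cons_zero, Fin.cons_succ]
    positivity
  · rw [Fin.sum_univ_succ]
    simp [Finset.smul_sum]
  · intro j
    refine Fin.cases ?_ (fun j => ?_) j
    · refine ⟨∑ j, (1 : ℝ) • v j, fun i => Fin.cases (fun h => absurd rfl h) (fun i _ => ?_) i⟩
      rw [Fin.cons_succ, hinner i fun _ => 1]
      exact one_pos
    -- The value `1 - 2 * m` makes the coordinates sum to `-m`, so the extra point has positive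
    -- inner product with this direction.
    · let g : Fin m → ℝ := fun i => if i = j then 1 - 2 * m else 1
      refine ⟨∑ j, g j • v j, fun i => Fin.cases (fun _ => ?_) (fun i hi => ?_) i⟩
      · have hsum : ∑ i, g i = -m := by
          have : ∀ i, g i = 1 - if i = j then 2 * (m : ℝ) else 0 := by
            intro i; simp only [g]; split_ifs <;> ring
          simp only [this, Finset.sum_sub_distrib, Finset.sum_ite_eq', Finset.mem_univ, if_true]
          simp; ring
        rw [Fin.cons_zero, inner_neg_left, real_inner_smul_left, sum_inner]
        simp only [hinner, hsum]
        nlinarith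
      · rw [Fin.cons_succ, hinner]
        have : i ≠ j := fun h => hi (by rw [h])
        simp [g, this]

end Geometry

/-! ### The set of hollow shapes has finite positive volume -/

section HollowConfigurations

variable (d m : ℕ)

/-- The configurations of `m` points that together with the origin form a hollow simplex at
scale `1`. -/
def hollowConfigurations : Set (Fin m → EuclideanSpace ℝ (Fin d)) :=
  {z | IsHollow (cechComplex (Fin.cons (0 : EuclideanSpace ℝ (Fin d)) z :
    Fin (m + 1) → EuclideanSpace ℝ (Fin d)) 1) Finset.univ}

variable {d m}

lemma measurable_finCons {E : Type*} [MeasurableSpace E] {m : ℕ} :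
    Measurable fun p : E × (Fin m → E) => (Fin.cons p.1 p.2 : Fin (m + 1) → E) := by
  refine measurable_pi_iff.2 fun i => Fin.cases ?_ (fun i => ?_) i
  · simpa using measurable_fst
  · simpa [Function.comp_def] using (measurable_pi_apply i).comp measurable_snd

lemma measurableSet_hollowConfigurations : MeasurableSet (hollowConfigurations d m) :=
  (measurable_finCons.comp measurable_prodMk_left)
    (measurableSet_setOf_isHollow (E := EuclideanSpace ℝ (Fin d)) Finset.univ 1)

lemma hollowConfigurations_subset (hm : 2 ≤ m) :
    hollowConfigurations d m ⊆ Metric.closedBall 0 1 := by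
  intro z hz
  rw [mem_closedBall_zero_iff, pi_norm_le_iff_of_nonneg zero_le_one]
  intro i
  have h := dist_le_of_mem_cechComplex (hz.pair_mem_faces (by simp; omega) (Finset.mem_univ 0)
    (Finset.mem_univ i.succ)) (i := 0) (j := i.succ) (by simp) (by simp)
  simpa using h

/-- Translating the first vertex of a stable hollow simplex to the origin yields a whole ball of
configurations. The condition `m ≤ d` supplies the orthonormal vectors. -/
lemma volume_hollowConfigurations_pos (hm : 1 ≤ m) (hmd : m ≤ d) :
    0 < volume (hollowConfigurations d m) := by
  have hv : Orthonormal ℝ fun i : Fin m => EuclideanSpace.single (Fin.castLE hmd i) (1 : ℝ) :=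
    EuclideanSpace.orthonormal_single.comp _ (Fin.castLE_injective hmd)
  obtain ⟨x, δ, hδ, h⟩ := exists_stable_hollow_of_orthonormal hm hv
  refine (Metric.measure_ball_pos volume (fun i : Fin m => x i.succ - x 0) hδ).trans_le
    (measure_mono fun z hz => ?_)
  rw [hollowConfigurations, Set.mem_ofPred_eq, ← cechComplex_add_smul _ (x 0) one_pos]
  refine h _ fun i => Fin.cases ?_ (fun i => ?_) i
  · simpa using hδ.le
  · rw [Metric.mem_ball, dist_pi_lt_iff hδ] at hz
    have := (hz i).le
    have hsub : x 0 + (1 : ℝ) • (Fin.cons 0 z : Fin (m + 1) → EuclideanSpace ℝ (Fin d)) i.succ -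
        x i.succ = z i - (x i.succ - x 0) := by
      rw [Fin.cons_succ, one_smul]; abel
    rwa [dist_eq_norm, hsub, ← dist_eq_norm]

end HollowConfigurations

/-! ### Densities of product measures -/

section ProductDensity

/-- The product of measures with densities has the product density. -/
lemma pi_withDensity_ofReal {ι α : Type*} [Fintype ι] [MeasurableSpace α] (ν : Measure α)
    [SigmaFinite ν] {g : α → ℝ} (hg : Integrable g ν) (hg0 : ∀ x, 0 ≤ g x) :
    Measure.pi (fun _ : ι => ν.withDensity fun x => ENNReal.ofReal (g x)) =
      (Measure.pi fun _ : ι => ν).withDensity fun x => ENNReal.ofReal (∏ i, g (x i)) := by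
  have : IsFiniteMeasure (ν.withDensity fun x => ENNReal.ofReal (g x)) :=
    isFiniteMeasure_withDensity_ofReal hg.2
  refine Measure.pi_eq fun s hs => ?_
  have hind : ∀ i, Integrable ((s i).indicator g) ν := fun i => hg.indicator (hs i)
  have hprod : (fun x : ι → α => (Set.univ.pi s).indicator
      (fun x => ENNReal.ofReal (∏ i, g (x i))) x) =
      fun x => ENNReal.ofReal (∏ i, (s i).indicator g (x i)) := by
    ext x
    by_cases hx : x ∈ Set.univ.pi s
    · rw [Set.indicator_of_mem hx]
      congr 1
      exact Finset.prod_congr rfl fun i _ => (Set.indicator_of_mem (hx i trivial) g).symm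
    · rw [Set.indicator_of_notMem hx]
      obtain ⟨i, hi⟩ : ∃ i, x i ∉ s i := by simpa [Set.mem_pi] using hx
      rw [Finset.prod_eq_zero (Finset.mem_univ i) (Set.indicator_of_notMem hi g),
        ENNReal.ofReal_zero]
  rw [withDensity_apply _ (MeasurableSet.univ_pi hs),
    ← lintegral_indicator (MeasurableSet.univ_pi hs), hprod,
    ← ofReal_integral_eq_lintegral_ofReal (Integrable.fintype_prod hind)
      (ae_of_all _ fun x => Finset.prod_nonneg fun i _ => Set.indicator_nonneg (fun a _ => hg0 a) _),
    integral_fintype_prod_eq_prod, ENNReal.ofReal_prod_of_nonneg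
      fun i _ => integral_nonneg fun a => Set.indicator_nonneg (fun a _ => hg0 a) _]
  refine Finset.prod_congr rfl fun i _ => ?_
  rw [withDensity_apply _ (hs i), ← lintegral_indicator (hs i),
    ofReal_integral_eq_lintegral_ofReal (hind i)
      (ae_of_all _ fun a => Set.indicator_nonneg (fun a _ => hg0 a) _)]
  refine lintegral_congr fun a => ?_
  by_cases ha : a ∈ s i <;> simp [ha]

end ProductDensity

/-! ### Continuity of translations in L¹ -/

section Translation

variable {E : Type*} [NormedAddCommGroup E] [MeasurableSpace E] [BorelSpace E]
  {ν : Measure E} [ν.IsAddLeftInvariant] [IsLocallyFiniteMeasure ν]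
  [ν.InnerRegularCompactLTTop]

/-- Translations act continuously on integrable functions. -/
lemma tendsto_integral_abs_translate_sub {g : E → ℝ} (hg : Integrable g ν) :
    Tendsto (fun v => ∫ a, |g (a + v) - g a| ∂ν) (𝓝 0) (𝓝 0) := by
  let φ : Lp ℝ 1 ν := hg.toL1 g
  let T : E → C(E, E) := fun v => ⟨fun a => v + a, by fun_prop⟩
  have hT : ∀ v, MeasurePreserving (T v) ν ν := fun v => measurePreserving_add_left ν v
  have hTc : Continuous T :=
    ContinuousMap.continuous_of_continuous_uncurry _ (by simp only [Function.uncurry_def, T, ContinuousMap.coe_mk]; fun_prop)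
  have hlim := (tendsto_const_nhds (x := φ)).compMeasurePreservingLp (hTc.tendsto 0)
    hT (hT 0) ENNReal.one_ne_top
  have hint : ∀ v, Integrable (fun a => g (v + a)) ν := fun v => (hT v).integrable_comp_of_integrable hg
  have hrep : ∀ v, Lp.compMeasurePreserving (T v) (hT v) φ = (hint v).toL1 _ := fun v => rfl
  have h0 : Lp.compMeasurePreserving (T 0) (hT 0) φ = φ := by
    rw [hrep]
    simp [φ]
  rw [h0, tendsto_iff_norm_sub_tendsto_zero] at hlim
  refine hlim.congr fun v => ?_
  rw [hrep, ← Integrable.toL1_sub, L1.norm_of_fun_eq_integral_norm]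
  simp [add_comm]

end Translation

/-! ### Telescoping of products -/

section Products

/-- Factors are exchanged one at a time; `1 ≤ M` lets a single power of `M` dominate all the partial
products. -/
lemma abs_prod_sub_prod_le {ι : Type*} (s : Finset ι) {b c : ι → ℝ} {M : ℝ} (hM : 1 ≤ M)
    (hb : ∀ i, |b i| ≤ M) (hc : ∀ i, |c i| ≤ M) :
    |∏ i ∈ s, b i - ∏ i ∈ s, c i| ≤ M ^ s.card * ∑ i ∈ s, |b i - c i| := by
  classical
  induction s using Finset.induction_on with
  | empty => simp
  | insert i s hi ih =>
    rw [Finset.prod_insert hi, Finset.prod_insert hi, Finset.sum_insert hi,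
      Finset.card_insert_of_notMem hi]
    have h1 : b i * ∏ j ∈ s, b j - c i * ∏ j ∈ s, c j =
      (b i - c i) * ∏ j ∈ s, b j + c i * (∏ j ∈ s, b j - ∏ j ∈ s, c j) := by ring
    have h2 : |∏ j ∈ s, b j| ≤ M ^ s.card := by
      rw [Finset.abs_prod, ← Finset.prod_const]
      exact Finset.prod_le_prod (fun _ _ => abs_nonneg _) fun j _ => hb j
    have h3 : M ^ s.card ≤ M ^ (s.card + 1) := pow_le_pow_right₀ hM (Nat.le_succ _)
    rw [h1]
    calc _ ≤ |b i - c i| * |∏ j ∈ s, b j| + |c i| * |∏ j ∈ s, b j - ∏ j ∈ s, c j| := by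
          rw [← abs_mul, ← abs_mul]; exact abs_add_le _ _
      _ ≤ |b i - c i| * M ^ (s.card + 1) + M * (M ^ s.card * ∑ j ∈ s, |b j - c j|) := by
          gcongr
          · exact h2.trans h3
          · exact hc i
      _ = _ := by ring

end Products

/-! ### The correlation function and its continuity at the origin -/

section Correlation

lemma abs_prod_translate_le {E : Type*} [AddCommGroup E] {m : ℕ} {g : E → ℝ} {M : ℝ}
    (hg0 : ∀ x, 0 ≤ g x) (hgM : ∀ x, g x ≤ M) (w : Fin m → E) (a : E) :
    |∏ i, g (a + w i)| ≤ M ^ m := by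
  rw [abs_of_nonneg (Finset.prod_nonneg fun i _ => hg0 _)]
  calc ∏ i, g (a + w i) ≤ ∏ _i : Fin m, M :=
        Finset.prod_le_prod (fun i _ => hg0 _) fun i _ => hgM _
    _ = M ^ m := by simp

variable {E : Type*} [NormedAddCommGroup E] [MeasurableSpace E] {ν : Measure E} {m : ℕ} {g : E → ℝ} {M : ℝ}

/-- The correlation function `w ↦ ∫ g(a) ∏ᵢ g(a + wᵢ) da` of a density. -/
def correlation (ν : Measure E) (g : E → ℝ) (w : Fin m → E) : ℝ :=
  ∫ a, g a * ∏ i, g (a + w i) ∂ν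

lemma integrable_correlation [BorelSpace E] (hgm : Measurable g) (hg : Integrable g ν) (hg0 : ∀ x, 0 ≤ g x)
    (hgM : ∀ x, g x ≤ M) (w : Fin m → E) :
    Integrable (fun a => g a * ∏ i, g (a + w i)) ν := by
  refine hg.mul_bdd (c := M ^ m) ?_ (ae_of_all _ (abs_prod_translate_le hg0 hgM w))
  exact (Finset.measurable_prod _ fun i _ => hgm.comp (by fun_prop)).aestronglyMeasurable

lemma stronglyMeasurable_correlation [BorelSpace E] [SecondCountableTopology E]
    [SFinite ν] (hgm : Measurable g) :
    StronglyMeasurable (correlation (m := m) ν g) := by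
  have : Measurable fun p : (Fin m → E) × E => g p.2 * ∏ i, g (p.2 + p.1 i) :=
    (hgm.comp measurable_snd).mul
      (Finset.measurable_prod _ fun i _ => hgm.comp (by fun_prop))
  exact this.stronglyMeasurable.integral_prod_right'

lemma abs_correlation_le (hg : Integrable g ν) (hg0 : ∀ x, 0 ≤ g x)
    (hgM : ∀ x, g x ≤ M) (w : Fin m → E) :
    |correlation ν g w| ≤ M ^ m * ∫ a, g a ∂ν := by
  rw [← integral_const_mul, ← Real.norm_eq_abs]
  refine norm_integral_le_of_norm_le (hg.const_mul _) (ae_of_all _ fun a => ?_)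
  rw [norm_mul, Real.norm_of_nonneg (hg0 a), mul_comm]
  exact mul_le_mul_of_nonneg_right (abs_prod_translate_le hg0 hgM w a) (hg0 a)

/-- Telescoping reduces the difference to L¹ distances between `g` and its translates, so no
continuity of `g` is needed. -/
lemma tendsto_correlation [BorelSpace E] [ν.IsAddLeftInvariant] [IsLocallyFiniteMeasure ν]
    [ν.InnerRegularCompactLTTop] (hgm : Measurable g) (hg : Integrable g ν) (hg0 : ∀ x, 0 ≤ g x)
    (hM : 1 ≤ M) (hgM : ∀ x, g x ≤ M) :
    Tendsto (correlation (m := m) ν g) (𝓝 0) (𝓝 (correlation ν g (0 : Fin m → E))) := by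
  rw [tendsto_iff_norm_sub_tendsto_zero]
  have habs : ∀ x, |g x| ≤ M := fun x => by rw [abs_of_nonneg (hg0 x)]; exact hgM x
  have hint : ∀ v, Integrable (fun a => |g (a + v) - g a|) ν := fun v => by
    have := (measurePreserving_add_left ν v).integrable_comp_of_integrable hg
    simp only [Function.comp_def, add_comm v] at this
    exact (this.sub hg).abs
  have hbound : ∀ w : Fin m → E, ‖correlation ν g w - correlation ν g (0 : Fin m → E)‖ ≤
      ∑ i, M ^ (m + 1) * ∫ a, |g (a + w i) - g a| ∂ν := by
    intro w
    rw [correlation, correlation, ← integral_sub (integrable_correlation hgm hg hg0 hgM _)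
      (integrable_correlation hgm hg hg0 hgM _)]
    simp_rw [← integral_const_mul]
    rw [← integral_finsetSum _ fun i _ => (hint _).const_mul _]
    refine norm_integral_le_of_norm_le (integrable_finsetSum _ fun i _ => (hint _).const_mul _)
      (ae_of_all _ fun a => ?_)
    rw [← mul_sub, norm_mul, ← Finset.mul_sum, pow_succ', mul_assoc]
    refine mul_le_mul (habs a) ?_ (norm_nonneg _) (by positivity)
    simpa using abs_prod_sub_prod_le Finset.univ hM (fun i => habs (a + w i)) fun i => habs (a + 0)
  refine squeeze_zero (fun _ => norm_nonneg _) hbound ?_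
  rw [show (0 : ℝ) = ∑ _i : Fin m, M ^ (m + 1) * 0 by simp]
  refine tendsto_finsetSum _ fun i _ => Tendsto.const_mul _ ?_
  have h0 : Tendsto (fun w : Fin m → E => w i) (𝓝 0) (𝓝 0) := (continuous_apply i).tendsto 0
  exact (tendsto_integral_abs_translate_sub hg).comp h0

end Correlation

/-! ### Small-scale probabilities of hollow and close configurations -/

section Asymptotics

lemma isProbabilityMeasure_withDensity_ofReal {α : Type*} [MeasurableSpace α] {ν : Measure α}
    {g : α → ℝ} (hg : Integrable g ν) (hg0 : ∀ x, 0 ≤ g x) (h1 : ∫ x, g x ∂ν = 1) :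
    IsProbabilityMeasure (ν.withDensity fun x => ENNReal.ofReal (g x)) :=
  ⟨by rw [withDensity_apply _ .univ, setLIntegral_univ,
    ← ofReal_integral_eq_lintegral_ofReal hg (ae_of_all _ hg0), h1, ENNReal.ofReal_one]⟩

variable {d m : ℕ} {g : EuclideanSpace ℝ (Fin d) → ℝ} {M : ℝ}

/-- The probability that `m + 1` independent points with density `g` form a hollow simplex at
scale `r`. -/
def hollowProb (g : EuclideanSpace ℝ (Fin d) → ℝ) (m : ℕ) (r : ℝ) : ℝ :=
  (Measure.pi fun _ : Fin (m + 1) => volume.withDensity fun x => ENNReal.ofReal (g x)).real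
    {x | IsHollow (cechComplex x r) Finset.univ}

/-- Substituting `a` and `a + r • z i` for the points turns hollowness at scale `r` into `z ∈
hollowConfigurations d m`, with Jacobian `r ^ (d * m)`. Fubini then integrates over `a` first. -/
lemma hollowProb_eq (hgm : Measurable g) (hg : Integrable g) (hg0 : ∀ x, 0 ≤ g x)
    (hgM : ∀ x, g x ≤ M) (hm : 2 ≤ m) {r : ℝ} (hr : 0 < r) :
    hollowProb g m r = r ^ (d * m) * ∫ z in hollowConfigurations d m,
      correlation volume g (r • z) := by
  let E := EuclideanSpace ℝ (Fin d)
  let A : Set (Fin (m + 1) → E) := {x | IsHollow (cechComplex x r) Finset.univ}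
  have hA : MeasurableSet A := measurableSet_setOf_isHollow _ _
  have hB : MeasurableSet (hollowConfigurations d m) := measurableSet_hollowConfigurations
  have hprod : Integrable fun x : Fin (m + 1) → E => ∏ i, g (x i) :=
    Integrable.fintype_prod fun _ => hg
  have hF : Integrable (A.indicator fun x : Fin (m + 1) → E => ∏ i, g (x i)) := hprod.indicator hA
  have hmp := (volume_preserving_piFinSuccAbove (fun _ : Fin (m + 1) => E) 0).symm
  have hcons : ∀ p : E × (Fin m → E),
      (MeasurableEquiv.piFinSuccAbove (fun _ : Fin (m + 1) => E) 0).symm p =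
        (Fin.cons p.1 p.2 : Fin (m + 1) → E) := fun p => by
    simp [MeasurableEquiv.piFinSuccAbove, Fin.insertNthEquiv]
  have hmem : ∀ (a : E) (z : Fin m → E), (Fin.cons a (fun i => a + r • z i) : Fin (m + 1) → E) ∈ A ↔
      z ∈ hollowConfigurations d m := by
    intro a z
    have : (Fin.cons a (fun i => a + r • z i) : Fin (m + 1) → E) =
        fun i => a + r • (Fin.cons 0 z : Fin (m + 1) → E) i := by
      ext1 i
      refine Fin.cases ?_ (fun i => ?_) i <;> simp
    change IsHollow (cechComplex _ r) _ ↔ IsHollow _ _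
    rw [this, cechComplex_add_smul _ _ hr]
  have h1 : hollowProb g m r = ∫ x, A.indicator (fun x : Fin (m + 1) → E => ∏ i, g (x i)) x := by
    rw [hollowProb, pi_withDensity_ofReal volume hg hg0, integral_indicator hA, measureReal_def,
      withDensity_apply _ hA, integral_eq_lintegral_of_nonneg_ae
      (ae_of_all _ fun x => Finset.prod_nonneg fun i _ => hg0 _) hprod.1.restrict]
    rfl
  have h2 : hollowProb g m r = ∫ a, ∫ y : Fin m → E,
      A.indicator (fun x : Fin (m + 1) → E => ∏ i, g (x i)) (Fin.cons a y) := by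
    rw [h1, ← hmp.integral_comp' (f := (MeasurableEquiv.piFinSuccAbove (fun _ => E) 0).symm)]
    simp_rw [hcons]
    refine integral_prod _ ?_
    have := hmp.integrable_comp_of_integrable hF
    simpa only [Function.comp_def, hcons, Measure.volume_eq_prod] using this
  have h3 : ∀ a, ∫ y : Fin m → E,
      A.indicator (fun x : Fin (m + 1) → E => ∏ i, g (x i)) (Fin.cons a y) =
      r ^ (d * m) * ∫ z, (hollowConfigurations d m).indicator
        (fun z => g a * ∏ i, g (a + r • z i)) z := by
    intro a
    have h4 := Measure.integral_comp_smul_of_nonneg (volume : Measure (Fin m → E))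
      (fun y => A.indicator (fun x : Fin (m + 1) → E => ∏ i, g (x i))
        (Fin.cons a ((fun _ => a) + y))) r (hR := hr.le)
    rw [integral_add_left_eq_self
      (fun y => A.indicator (fun x : Fin (m + 1) → E => ∏ i, g (x i)) (Fin.cons a y))
      (fun _ => a)] at h4
    have hfr : Module.finrank ℝ (Fin m → E) = d * m := by
      rw [Module.finrank_pi_fintype]; simp [E, mul_comm]
    rw [hfr, smul_eq_mul, eq_inv_mul_iff_mul_eq₀ (by positivity)] at h4
    rw [← h4]
    congr 2
    ext z
    change A.indicator _ (Fin.cons a (fun i => a + r • z i)) = _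
    by_cases hz : z ∈ hollowConfigurations d m
    · rw [Set.indicator_of_mem ((hmem a z).2 hz), Set.indicator_of_mem hz, Fin.prod_univ_succ]
      simp
    · rw [Set.indicator_of_notMem (mt (hmem a z).1 hz), Set.indicator_of_notMem hz]
  rw [h2]
  simp_rw [h3]
  rw [integral_const_mul, integral_integral_swap, ← integral_indicator hB]
  · congr 2
    ext z
    by_cases hz : z ∈ hollowConfigurations d m
    · simp [hz, correlation, E]
    · simp [hz]
  -- Fubini is justified by boundedness of the hollow configurations: the integrand is `g a` times
  -- an integrable indicator times a factor at most `M ^ m`.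
  · have hfin : IsFiniteMeasure
        ((volume : Measure (Fin m → E)).restrict (hollowConfigurations d m)) :=
      ⟨by rw [Measure.restrict_apply_univ]
          exact (measure_mono (hollowConfigurations_subset hm)).trans_lt measure_closedBall_lt_top⟩
    have h5 : Integrable (fun p : E × (Fin m → E) => g p.1 *
        (hollowConfigurations d m).indicator (fun _ => (1 : ℝ)) p.2) (volume.prod volume) :=
      hg.mul_prod ((integrable_indicator_iff hB).2 (integrable_const 1))
    have h6 : Measurable fun p : E × (Fin m → E) => ∏ i, g (p.1 + r • p.2 i) :=
      Finset.measurable_prod _ fun i _ => hgm.comp (by fun_prop)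
    refine (h5.mul_bdd (c := M ^ m) h6.aestronglyMeasurable
      (ae_of_all _ fun p => abs_prod_translate_le hg0 hgM (r • p.2) p.1)).congr
      (ae_of_all _ fun p => ?_)
    by_cases hz : p.2 ∈ hollowConfigurations d m <;> simp [Function.uncurry, hz]

/-- Dominated convergence on a set of finite volume; the correlation at the origin is the integral
of `g ^ (m + 1)`. -/
lemma tendsto_hollowProb_div (hgm : Measurable g) (hg : Integrable g) (hg0 : ∀ x, 0 ≤ g x)
    (hM : 1 ≤ M) (hgM : ∀ x, g x ≤ M) (hm : 2 ≤ m) {r : ℕ → ℝ} (hr : ∀ n, 0 < r n)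
    (hr0 : Tendsto r atTop (𝓝 0)) :
    Tendsto (fun n => hollowProb g m (r n) / r n ^ (d * m)) atTop
      (𝓝 (volume.real (hollowConfigurations d m) * ∫ x, g x ^ (m + 1))) := by
  have hB : MeasurableSet (hollowConfigurations d m) := measurableSet_hollowConfigurations
  have hfin : IsFiniteMeasure ((volume : Measure (Fin m → EuclideanSpace ℝ (Fin d))).restrict
      (hollowConfigurations d m)) :=
    ⟨by rw [Measure.restrict_apply_univ]
        exact (measure_mono (hollowConfigurations_subset hm)).trans_lt measure_closedBall_lt_top⟩
  have h1 : ∀ n, hollowProb g m (r n) / r n ^ (d * m) =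
      ∫ z in hollowConfigurations d m, correlation volume g (r n • z) := by
    intro n
    rw [hollowProb_eq hgm hg hg0 hgM hm (hr n), mul_div_cancel_left₀ _ (pow_ne_zero _ (hr n).ne')]
  have h2 : volume.real (hollowConfigurations d m) * ∫ x, g x ^ (m + 1) =
      ∫ z in hollowConfigurations d m, correlation volume g (0 : Fin m → _) := by
    rw [setIntegral_const, smul_eq_mul]
    congr 2
    ext x
    simp [pow_succ']
  simp_rw [h1]
  rw [h2]
  refine tendsto_integral_of_dominated_convergence (fun _ => M ^ m * ∫ a, g a)
    (fun n => ?_) (integrable_const _) (fun n => ae_of_all _ fun z => abs_correlation_le hg hg0 hgM _)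
    (ae_of_all _ fun z => ?_)
  · exact ((stronglyMeasurable_correlation hgm).comp_measurable
      (measurable_const_smul (r n))).aestronglyMeasurable
  · have : Tendsto (fun n => r n • z) atTop (𝓝 0) := by simpa using hr0.smul_const z
    exact (tendsto_correlation hgm hg hg0 hM hgM).comp this

lemma integral_pow_pos (hg : Integrable g) (hg0 : ∀ x, 0 ≤ g x)
    (hgM : ∀ x, g x ≤ M) (hgm : Measurable g) (h1 : 0 < ∫ x, g x) :
    0 < ∫ x, g x ^ (m + 1) := by
  have hint : Integrable fun x => g x ^ (m + 1) := by
    simpa [correlation, pow_succ'] using integrable_correlation (m := m) hgm hg hg0 hgM 0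
  rw [integral_pos_iff_support_of_nonneg hg0 hg] at h1
  rw [integral_pos_iff_support_of_nonneg (fun x => pow_nonneg (hg0 x) _) hint]
  rwa [show (Function.support fun x => g x ^ (m + 1)) = Function.support g by ext x; simp]

/-- The probability that `m + 1` independent points with a bounded density are close to each
other. -/
lemma pi_close_le (hg : Integrable g) (hg0 : ∀ x, 0 ≤ g x)
    (hgM : ∀ x, g x ≤ M) (h1 : ∫ x, g x = 1) (hM : 0 ≤ M) {R : ℝ} (hR : 0 ≤ R) :
    (Measure.pi fun _ : Fin (m + 1) => volume.withDensity fun x => ENNReal.ofReal (g x)).real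
      {x | ∀ i j, dist (x i) (x j) ≤ R} ≤
      (M * volume.real (Metric.closedBall (0 : EuclideanSpace ℝ (Fin d)) 1)) ^ m * R ^ (d * m) := by
  let E := EuclideanSpace ℝ (Fin d)
  let μ : Measure E := volume.withDensity fun x => ENNReal.ofReal (g x)
  have hμ : IsProbabilityMeasure μ := isProbabilityMeasure_withDensity_ofReal hg hg0 h1
  let C : ℝ := M * volume.real (Metric.closedBall (0 : E) 1) * R ^ d
  have hC : 0 ≤ C := by positivity
  have hball : ∀ a, μ (Metric.closedBall a R) ≤ ENNReal.ofReal C := by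
    intro a
    calc μ (Metric.closedBall a R) = ∫⁻ x in Metric.closedBall a R, ENNReal.ofReal (g x) :=
          withDensity_apply _ Metric.isClosed_closedBall.measurableSet
      _ ≤ ∫⁻ x in Metric.closedBall a R, ENNReal.ofReal M :=
          lintegral_mono fun x => ENNReal.ofReal_le_ofReal (hgM x)
      _ = ENNReal.ofReal C := by
          rw [setLIntegral_const, Measure.addHaar_closedBall' _ _ hR, finrank_euclideanSpace_fin,
            ENNReal.ofReal_mul (by positivity), ENNReal.ofReal_mul hM, ofReal_measureReal
            measure_closedBall_lt_top.ne]
          ring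
  have hmp := measurePreserving_piFinSuccAbove (fun _ : Fin (m + 1) => μ) 0
  -- Only distances to the first point are kept. Given that point, the others fall independently in
  -- a ball of mass at most `C`.
  let B : Set (E × (Fin m → E)) := {p | ∀ i, dist (p.2 i) p.1 ≤ R}
  have hB : MeasurableSet B := by
    simp only [B, Set.ofPred_forall]
    exact MeasurableSet.iInter fun i => measurableSet_le (by fun_prop) measurable_const
  have hle : (Measure.pi fun _ : Fin (m + 1) => μ) {x | ∀ i j, dist (x i) (x j) ≤ R} ≤
      ENNReal.ofReal (C ^ m) := by
    calc (Measure.pi fun _ : Fin (m + 1) => μ) {x | ∀ i j, dist (x i) (x j) ≤ R}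
        ≤ (Measure.pi fun _ : Fin (m + 1) => μ)
          (MeasurableEquiv.piFinSuccAbove (fun _ => E) 0 ⁻¹' B) := measure_mono fun x hx i => hx _ _
      _ = (μ.prod (Measure.pi fun _ : Fin m => μ)) B := hmp.measure_preimage hB.nullMeasurableSet
      _ = ∫⁻ a, (Measure.pi fun _ : Fin m => μ) (Prod.mk a ⁻¹' B) ∂μ := Measure.prod_apply hB
      _ ≤ ∫⁻ a, ENNReal.ofReal (C ^ m) ∂μ := by
          refine lintegral_mono fun a => ?_
          have : Prod.mk a ⁻¹' B = Set.univ.pi fun _ => Metric.closedBall a R := by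
            ext y; simp [B]
          rw [this, Measure.pi_pi, ENNReal.ofReal_pow hC]
          calc ∏ _i : Fin m, μ (Metric.closedBall a R) ≤ ∏ _i : Fin m, ENNReal.ofReal C :=
                Finset.prod_le_prod' fun _ _ => hball a
            _ = _ := by simp
      _ = ENNReal.ofReal (C ^ m) := by simp
  calc _ ≤ C ^ m := ENNReal.toReal_le_of_le_ofReal (by positivity) hle
    _ = _ := by rw [mul_pow, ← pow_mul]

end Asymptotics

/-! ### Expected counts of index sets -/

section Expectations

variable {Ω E : Type*} [MeasurableSpace Ω] {P : Measure Ω} [MeasurableSpace E]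
  {X : ℕ → Ω → E} {μ : Measure E}

lemma map_precomp_eq_pi (hX : ∀ i, HasLaw (X i) μ P) (hind : iIndepFun X P) {m : ℕ} {e : Fin m → ℕ}
    (he : e.Injective) :
    P.map (fun ω i => X (e i) ω) = Measure.pi fun _ : Fin m => μ := by
  rw [(hind.precomp he).map_fun_eq_pi_map fun i => (hX _).aemeasurable]
  simp_rw [(hX _).map_eq]

lemma aemeasurable_precomp (hX : ∀ i, HasLaw (X i) μ P) {m : ℕ} (e : Fin m → ℕ) :
    AEMeasurable (fun ω i => X (e i) ω) P :=
  aemeasurable_pi_lambda _ fun _ => (hX _).aemeasurable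

/-- The expected number of sets of indices of a given size whose points satisfy a given property. -/
lemma integral_card_eq [IsProbabilityMeasure P] (hX : ∀ i, HasLaw (X i) μ P) (hind : iIndepFun X P) {n m : ℕ}
    {A : Set (Fin m → E)} (hA : MeasurableSet A) (Q : Ω → Finset (Finset (Fin n)))
    (hcard : ∀ ω, ∀ T ∈ Q ω, T.card = m)
    (hQ : ∀ ω T (h : T.card = m),
      T ∈ Q ω ↔ (fun i => X (T.orderEmbOfFin h i) ω) ∈ A) :
    Integrable (fun ω => ((Q ω).card : ℝ)) P ∧
      ∫ ω, ((Q ω).card : ℝ) ∂P = n.choose m * (Measure.pi fun _ : Fin m => μ).real A := by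
  classical
  have hsum : (fun ω => ((Q ω).card : ℝ)) = fun ω => ∑ T ∈ Finset.powersetCard m Finset.univ,
      {ω | T ∈ Q ω}.indicator (fun _ => (1 : ℝ)) ω := by
    ext ω
    have : Q ω = (Finset.powersetCard m Finset.univ).filter fun T => T ∈ Q ω := by
      ext T
      simp only [Finset.mem_filter, Finset.mem_powersetCard_univ]
      exact ⟨fun h => ⟨hcard ω T h, h⟩, fun h => h.2⟩
    rw [this, Finset.card_filter]
    push_cast
    refine Finset.sum_congr rfl fun T _ => ?_
    by_cases h : T ∈ Q ω
    · have h' : ω ∈ {ω | T ∈ Q ω} := h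
      rw [if_pos h, Set.indicator_of_mem h']
    · have h' : ω ∉ {ω | T ∈ Q ω} := h
      rw [if_neg h, Set.indicator_of_notMem h']
  have hset : ∀ T (h : T.card = m), {ω | T ∈ Q ω} =
      (fun ω (i : Fin m) => X (T.orderEmbOfFin h i) ω) ⁻¹' A := fun T h => by
    ext ω; exact hQ ω T h
  -- The variables are only almost everywhere measurable, so these events are null-measurable rather
  -- than measurable.
  have hnull : ∀ T ∈ Finset.powersetCard m (Finset.univ : Finset (Fin n)),
      NullMeasurableSet {ω | T ∈ Q ω} P := fun T hT => by
    rw [hset T (Finset.mem_powersetCard_univ.1 hT)]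
    exact (aemeasurable_precomp hX _).nullMeasurableSet_preimage hA
  have hint : ∀ T ∈ Finset.powersetCard m (Finset.univ : Finset (Fin n)),
      Integrable ({ω | T ∈ Q ω}.indicator fun _ => (1 : ℝ)) P := fun T hT =>
    (integrable_const 1).indicator₀ (hnull T hT)
  rw [hsum]
  refine ⟨integrable_finsetSum _ hint, ?_⟩
  rw [integral_finsetSum _ hint]
  have hprob : ∀ T ∈ Finset.powersetCard m (Finset.univ : Finset (Fin n)),
      ∫ ω, {ω | T ∈ Q ω}.indicator (fun _ => (1 : ℝ)) ω ∂P =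
        (Measure.pi fun _ : Fin m => μ).real A := by
    intro T hT
    have h := Finset.mem_powersetCard_univ.1 hT
    rw [integral_indicator₀ (hnull T hT), setIntegral_const, smul_eq_mul, mul_one, hset T h,
      ← map_precomp_eq_pi hX hind (e := fun i => T.orderEmbOfFin h i)
        (Fin.val_injective.comp (T.orderEmbOfFin h).injective),
      map_measureReal_apply_of_aemeasurable (aemeasurable_precomp hX _) hA]
  rw [Finset.sum_congr rfl hprob, Finset.sum_const, Finset.card_powersetCard, Finset.card_univ,
    Fintype.card_fin, nsmul_eq_mul]

end Expectations

/-! ### Statistics of the random complex -/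

section RandomCech

variable {Ω : Type*} [MeasurableSpace Ω] {P : Measure Ω} [IsProbabilityMeasure P] {d : ℕ}
  {X : ℕ → Ω → EuclideanSpace ℝ (Fin d)} {μ : Measure (EuclideanSpace ℝ (Fin d))}

/-- Every statistic of the random Čech complex is integrable. -/
lemma integrable_randomCech (hX : ∀ i, HasLaw (X i) μ P) (n : ℕ) (r : ℝ)
    (φ : PreAbstractSimplicialComplex (Fin n) → ℝ) :
    Integrable (fun ω => φ (randomCech X n r ω)) P := by
  classical
  let G : (Fin n → EuclideanSpace ℝ (Fin d)) → Finset (Finset (Fin n)) := fun x =>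
    {σ | σ ∈ (cechComplex x r).faces}
  have hG : ∀ x σ, σ ∈ G x ↔ σ ∈ (cechComplex x r).faces := by simp [G]
  -- A statistic factors through the finite set of faces, hence takes finitely many values; the
  -- default `0` is never reached from a complex.
  let ψ : Finset (Finset (Fin n)) → ℝ := fun S =>
    if h : ∃ K : PreAbstractSimplicialComplex (Fin n), K.faces = S then φ h.choose else 0
  have hψ : ∀ x, φ (cechComplex x r) = ψ (G x) := by
    intro x
    have h : ∃ K : PreAbstractSimplicialComplex (Fin n), K.faces = (G x : Set (Finset (Fin n))) :=
      ⟨cechComplex x r, by ext σ; simp [hG]⟩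
    simp only [ψ, dif_pos h]
    congr 1
    ext σ
    rw [h.choose_spec, Finset.mem_coe, hG]
  let _ : MeasurableSpace (Finset (Finset (Fin n))) := ⊤
  have hGm : Measurable G := by
    refine measurable_to_countable' fun S => ?_
    have : G ⁻¹' {S} = ⋂ σ, {x | σ ∈ (cechComplex x r).faces ↔ σ ∈ S} := by
      ext x
      simp only [Set.mem_preimage, Set.mem_singleton_iff, Finset.ext_iff, hG, Set.mem_iInter]
      rfl
    rw [this]
    refine MeasurableSet.iInter fun σ => ?_
    have h := (isClosed_setOf_mem_cechComplex (E := EuclideanSpace ℝ (Fin d)) σ r).measurableSet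
    by_cases hσ : σ ∈ S
    · simpa only [hσ, iff_true] using h
    · simp only [hσ, iff_false]
      exact h.compl
  have hm : Measurable fun x : Fin n → EuclideanSpace ℝ (Fin d) => φ (cechComplex x r) := by
    simp_rw [hψ]
    exact (measurable_from_top (f := ψ)).comp hGm
  obtain ⟨C, hC⟩ := (Set.finite_range fun S => ‖ψ S‖).bddAbove
  refine Integrable.of_bound (C := C) ?_ (ae_of_all _ fun ω => ?_)
  · exact (hm.comp_aemeasurable
      (aemeasurable_precomp hX fun i : Fin n => (i : ℕ))).aestronglyMeasurable
  · rw [randomCech, hψ]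
    exact hC ⟨_, rfl⟩

lemma integral_card_hollowSets (hX : ∀ i, HasLaw (X i) μ P) (hind : iIndepFun X P)
    (n m : ℕ) (r : ℝ) :
    ∫ ω, ((hollowSets (randomCech X n r ω) m).card : ℝ) ∂P = n.choose m *
      (Measure.pi fun _ : Fin m => μ).real {x | IsHollow (cechComplex x r) Finset.univ} := by
  refine (integral_card_eq hX hind (measurableSet_setOf_isHollow _ r) _
    (fun ω T hT => (mem_hollowSets.1 hT).1) fun ω T h => ?_).2
  rw [mem_hollowSets, and_iff_right h]
  conv_lhs => rw [← Finset.map_orderEmbOfFin_univ T h]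
  exact isHollow_map_cechComplex_iff _ _

lemma integral_card_closeSets (hX : ∀ i, HasLaw (X i) μ P) (hind : iIndepFun X P)
    (n m : ℕ) (R : ℝ) :
    Integrable (fun ω => ((closeSets (fun i : Fin n => X i ω) R m).card : ℝ)) P ∧
    ∫ ω, ((closeSets (fun i : Fin n => X i ω) R m).card : ℝ) ∂P = n.choose m *
      (Measure.pi fun _ : Fin m => μ).real {x | ∀ i j, dist (x i) (x j) ≤ R} := by
  have hm : MeasurableSet {x : Fin m → EuclideanSpace ℝ (Fin d) | ∀ i j, dist (x i) (x j) ≤ R} := by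
    simp only [Set.ofPred_forall]
    exact MeasurableSet.iInter fun i => MeasurableSet.iInter fun j =>
      measurableSet_le (by fun_prop) measurable_const
  refine integral_card_eq hX hind hm _
    (fun ω T hT => (mem_closeSets.1 hT).1) fun ω T h => ?_
  rw [mem_closeSets, and_iff_right h]
  conv_lhs => rw [← Finset.map_orderEmbOfFin_univ T h]
  simp only [Finset.forall_mem_map, Finset.mem_univ, true_imp_iff]
  rfl

/-- Both statistics are close to the expected number of hollow sets. -/
lemma expectation_bounds (hX : ∀ i, HasLaw (X i) μ P) (hind : iIndepFun X P) (F : Type*) [Field F]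
    {k : ℕ} (hk : 1 ≤ k) (n : ℕ) {r : ℝ} (hr : 0 < r) :
    |∫ ω, (betti F (randomCech X n r ω) k : ℝ) ∂P -
      ∫ ω, ((hollowSets (randomCech X n r ω) (k + 2)).card : ℝ) ∂P| ≤
      2 ^ (k + 3) * ∫ ω, ((closeSets (fun i : Fin n => X i ω) (3 * r) (k + 3)).card : ℝ) ∂P ∧
    |∫ ω, (simplexBoundaryComponents (randomCech X n r ω) (k + 1) : ℝ) ∂P -
      ∫ ω, ((hollowSets (randomCech X n r ω) (k + 2)).card : ℝ) ∂P| ≤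
      2 ^ (k + 3) * ∫ ω, ((closeSets (fun i : Fin n => X i ω) (3 * r) (k + 3)).card : ℝ) ∂P := by
  have hi := fun φ => integrable_randomCech hX n r φ
  have hc := (integral_card_closeSets hX hind n (k + 3) (3 * r)).1.const_mul (2 ^ (k + 3))
  -- For every outcome all three counts lie between the isolated hollow count and that count plus `2
  -- ^ (k + 3) * M`.
  have key : ∀ ω, let K := randomCech X n r ω
      let M := (closeSets (fun i : Fin n => X i ω) (3 * r) (k + 3)).card
      simplexBoundaryComponents K (k + 1) = (isolatedHollow K (k + 2)).card ∧
      (isolatedHollow K (k + 2)).card ≤ betti F K k ∧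
      betti F K k ≤ (isolatedHollow K (k + 2)).card + 2 ^ (k + 3) * M ∧
      (isolatedHollow K (k + 2)).card ≤ (hollowSets K (k + 2)).card ∧
      (hollowSets K (k + 2)).card ≤ (isolatedHollow K (k + 2)).card + 2 ^ (k + 3) * M := by
    intro ω K M
    exact ⟨simplexBoundaryComponents_eq (fun v => singleton_mem_cechComplex hr.le v) (by omega),
      card_isolatedHollow_le_betti hk,
      (betti_le hk).trans (Nat.add_le_add_left (card_crowdedFaces_cechComplex_le hr.le (k + 1)) _),
      card_isolatedHollow_le K _, card_hollowSets_cechComplex_le hr.le (by omega)⟩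
  constructor
  · rw [← integral_const_mul, ← integral_sub (hi fun K => betti F K k)
      (hi fun K => (hollowSets K (k + 2)).card), ← Real.norm_eq_abs]
    refine norm_integral_le_of_norm_le hc (ae_of_all _ fun ω => ?_)
    obtain ⟨h1, h2, h3, h4, h5⟩ := key ω
    rw [Real.norm_eq_abs, abs_le]
    constructor
    · have := h5.trans (Nat.add_le_add_right h2 _)
      have : ((hollowSets (randomCech X n r ω) (k + 2)).card : ℝ) ≤ _ := Nat.cast_le.2 this
      push_cast at this
      linarith
    · have := h3.trans (Nat.add_le_add_right h4 _)
      have : (betti F (randomCech X n r ω) k : ℝ) ≤ _ := Nat.cast_le.2 this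
      push_cast at this
      linarith
  · rw [← integral_const_mul, ← integral_sub (hi fun K => simplexBoundaryComponents K (k + 1))
      (hi fun K => (hollowSets K (k + 2)).card), ← Real.norm_eq_abs]
    refine norm_integral_le_of_norm_le hc (ae_of_all _ fun ω => ?_)
    obtain ⟨h1, h2, h3, h4, h5⟩ := key ω
    rw [Real.norm_eq_abs, abs_le, h1]
    constructor
    · have : ((hollowSets (randomCech X n r ω) (k + 2)).card : ℝ) ≤ _ := Nat.cast_le.2 h5
      push_cast at this
      linarith
    · have : ((isolatedHollow (randomCech X n r ω) (k + 2)).card : ℝ) ≤ _ := Nat.cast_le.2 h4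
      have h0 : (0 : ℝ) ≤ 2 ^ (k + 3) *
        (closeSets (fun i : Fin n => X i ω) (3 * r) (k + 3)).card := by positivity
      linarith

end RandomCech

/-! ### Consequences of the decay of the radii -/

section Scaling

variable {r : ℕ → ℝ} {d : ℕ} {ε : ℝ}

lemma tendsto_zero_of_isBigO_rpow (hε : 0 < ε)
    (hr : r =O[atTop] fun n : ℕ => (n : ℝ) ^ (-(1 / (d : ℝ)) - ε)) :
    Tendsto r atTop (𝓝 0) := by
  refine hr.trans_tendsto ?_
  have h : 0 < 1 / (d : ℝ) + ε := by positivity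
  refine ((tendsto_rpow_neg_atTop h).comp tendsto_natCast_atTop_atTop).congr fun n => ?_
  simp only [Function.comp_apply]
  congr 1
  ring

/-- The exponent is `1 + d * (-(1 / d) - ε) = -(ε * d)`, negative because `ε > 0`. -/
lemma tendsto_natCast_mul_pow_of_isBigO_rpow (hd : d ≠ 0) (hε : 0 < ε)
    (hr : r =O[atTop] fun n : ℕ => (n : ℝ) ^ (-(1 / (d : ℝ)) - ε)) :
    Tendsto (fun n : ℕ => (n : ℝ) * r n ^ d) atTop (𝓝 0) := by
  refine ((isBigO_refl (fun n : ℕ => (n : ℝ)) atTop).mul (hr.pow d)).trans_tendsto ?_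
  have hd' : (0 : ℝ) < d := by exact_mod_cast Nat.pos_of_ne_zero hd
  refine ((tendsto_rpow_neg_atTop (mul_pos hε hd')).comp tendsto_natCast_atTop_atTop).congr' ?_
  filter_upwards [eventually_gt_atTop 0] with n hn
  have hn' : (0 : ℝ) < n := by exact_mod_cast hn
  simp only [Function.comp_apply]
  rw [← Real.rpow_natCast, ← Real.rpow_mul hn'.le]
  nth_rewrite 2 [← Real.rpow_one (n : ℝ)]
  rw [← Real.rpow_add hn']
  congr 1
  field_simp
  ring

lemma tendsto_choose_div_pow (m : ℕ) :
    Tendsto (fun n : ℕ => (n.choose m : ℝ) / (n : ℝ) ^ m) atTop (𝓝 (1 / (m.factorial : ℝ))) := by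
  have h := (isEquivalent_iff_tendsto_one (by
    filter_upwards [eventually_gt_atTop 0] with n hn
    positivity)).1 (isEquivalent_choose m)
  have h2 := h.mul_const (1 / (m.factorial : ℝ))
  rw [one_mul] at h2
  refine h2.congr fun n => ?_
  simp only [Pi.div_apply]
  field_simp

end Scaling

/-! ### Measurable representative of the density -/

section Density

/-- A bounded nonnegative density has a measurable bounded nonnegative version. -/
lemma exists_measurable_version {α : Type*} [MeasurableSpace α] {ν : Measure α} {f : α → ℝ}
    (hf : AEMeasurable f ν) (hf0 : ∀ x, 0 ≤ f x) (hfb : ∃ M : ℝ, ∀ x, f x ≤ M) :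
    ∃ (g : α → ℝ) (M : ℝ), 1 ≤ M ∧ Measurable g ∧ (∀ x, 0 ≤ g x) ∧ (∀ x, g x ≤ M) ∧ f =ᵐ[ν] g := by
  obtain ⟨M, hM⟩ := hfb
  refine ⟨fun x => max 0 (min (max 1 M) (hf.mk f x)), max 1 M, le_max_left _ _,
    measurable_const.max (measurable_const.min hf.measurable_mk), fun x => le_max_left _ _,
    fun x => max_le (zero_le_one.trans (le_max_left _ _)) (min_le_left _ _), ?_⟩
  filter_upwards [hf.ae_eq_mk] with x hx
  rw [← hx, min_eq_right ((hM x).trans (le_max_right _ _)), max_eq_right (hf0 x)]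

end Density
end CechBetti

end

/-! ### The limit theorem -/

open CechBetti in
theorem theorem3p2 (d k : ℕ) (hd : 2 ≤ d) (hk : 1 ≤ k) (hkd : k ≤ d - 1)
    (f : EuclideanSpace ℝ (Fin d) → ℝ)
    (hf_meas : AEMeasurable f volume) (hf_nonneg : ∀ x, 0 ≤ f x)
    (hf_bdd : ∃ M : ℝ, ∀ x, f x ≤ M) (hf_int : ∫ x, f x = 1) :
    ∃ D : ℝ, 0 < D ∧
      ∀ (F : Type*) [Field F]
        (Ω : Type*) [MeasurableSpace Ω] (P : Measure Ω) [IsProbabilityMeasure P]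
        (X : ℕ → Ω → EuclideanSpace ℝ (Fin d))
        (_ : ∀ i, HasLaw (X i) (volume.withDensity fun x => ENNReal.ofReal (f x)) P)
        (_ : iIndepFun X P)
        (ε : ℝ) (_ : 0 < ε) (r : ℕ → ℝ) (_ : ∀ n, 0 < r n)
        (_ : r =O[atTop] fun n : ℕ => (n : ℝ) ^ (-(1 / (d : ℝ)) - ε)),
        (∀ n, Integrable (fun ω => (betti F (randomCech X n (r n) ω) k : ℝ)) P) ∧
        (∀ n, Integrable
          (fun ω => (simplexBoundaryComponents (randomCech X n (r n) ω) (k + 1) : ℝ)) P) ∧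
        Tendsto
          (fun n : ℕ => (∫ ω, (betti F (randomCech X n (r n) ω) k : ℝ) ∂P) /
            ((n : ℝ) ^ (k + 2) * r n ^ (d * (k + 1))))
          atTop (𝓝 D) ∧
        Tendsto
          (fun n : ℕ => (∫ ω, (betti F (randomCech X n (r n) ω) k : ℝ) ∂P) /
            (∫ ω, (simplexBoundaryComponents (randomCech X n (r n) ω) (k + 1) : ℝ) ∂P))
          atTop (𝓝 1) := by
  obtain ⟨g, M, hM, hgm, hg0, hgM, hfg⟩ := exists_measurable_version hf_meas hf_nonneg hf_bdd
  have hg1 : ∫ x, g x = 1 := by rw [← integral_congr_ae hfg, hf_int]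
  have hg : Integrable g := by
    -- A non-integrable function has Bochner integral `0`, not `1`.
    by_contra h
    rw [integral_undef h] at hg1
    exact zero_ne_one hg1
  have hμ : (volume.withDensity fun x => ENNReal.ofReal (f x)) =
      volume.withDensity fun x => ENNReal.ofReal (g x) :=
    withDensity_congr_ae (hfg.mono fun x hx => by simp only [hx])
  rw [hμ]
  let L : ℝ := volume.real (hollowConfigurations d (k + 1)) * ∫ x, g x ^ (k + 2)
  have hL : 0 < L := by
    refine mul_pos (ENNReal.toReal_pos (volume_hollowConfigurations_pos (by omega) (by omega)).ne'
      ((measure_mono (hollowConfigurations_subset (by omega))).trans_lt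
        measure_closedBall_lt_top).ne) ?_
    exact integral_pow_pos hg hg0 hgM hgm (by rw [hg1]; exact one_pos)
  let D : ℝ := 1 / ((k + 2).factorial : ℝ) * L
  have hD : 0 < D := by positivity
  refine ⟨D, hD, ?_⟩
  intro F _ Ω _ P _ X hX hind ε hε r hr hrO
  refine ⟨fun n => integrable_randomCech hX n (r n) fun K => betti F K k,
    fun n => integrable_randomCech hX n (r n) fun K => simplexBoundaryComponents K (k + 1), ?_⟩
  have hr0 := tendsto_zero_of_isBigO_rpow hε hrO
  have hnr := tendsto_natCast_mul_pow_of_isBigO_rpow (by omega) hε hrO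
  let N : ℕ → ℝ := fun n => (n : ℝ) ^ (k + 2) * r n ^ (d * (k + 1))
  have hN : ∀ᶠ n in atTop, 0 < N n := by
    filter_upwards [eventually_gt_atTop 0] with n hn
    have := hr n
    positivity
  let H : ℕ → ℝ := fun n => ∫ ω, ((hollowSets (randomCech X n (r n) ω) (k + 2)).card : ℝ) ∂P
  let C : ℕ → ℝ := fun n =>
    2 ^ (k + 3) * ∫ ω, ((closeSets (fun i : Fin n => X i ω) (3 * r n) (k + 3)).card : ℝ) ∂P
  have hH : Tendsto (fun n => H n / N n) atTop (𝓝 D) := by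
    refine ((tendsto_choose_div_pow (k + 2)).mul (tendsto_hollowProb_div hgm hg hg0 hM hgM
      (m := k + 1) (by omega) hr hr0)).congr fun n => ?_
    simp only [H, N, integral_card_hollowSets hX hind, hollowProb]
    rw [div_mul_div_comm]
  -- Chosen so that `C n ≤ B * (n * r n ^ d) * N n`; the power of `3` comes from the closeness
  -- radius `3 * r n`.
  let B : ℝ := 2 ^ (k + 3) *
    ((M * volume.real (Metric.closedBall (0 : EuclideanSpace ℝ (Fin d)) 1)) ^ (k + 2) *
      3 ^ (d * (k + 2)))
  have hC : Tendsto (fun n => C n / N n) atTop (𝓝 0) := by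
    have hlim := hnr.const_mul B
    rw [mul_zero] at hlim
    refine squeeze_zero' ?_ ?_ hlim
    · filter_upwards [hN] with n hn
      exact div_nonneg (mul_nonneg (by positivity) (integral_nonneg fun _ => Nat.cast_nonneg _)) hn.le
    · filter_upwards [hN] with n hn
      rw [div_le_iff₀ hn]
      have hclose := pi_close_le (m := k + 2) hg hg0 hgM hg1 (zero_le_one.trans hM)
        (R := 3 * r n) (by have := hr n; positivity)
      have hchoose : (n.choose (k + 3) : ℝ) ≤ (n : ℝ) ^ (k + 3) := by
        exact_mod_cast Nat.choose_le_pow n (k + 3)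
      simp only [C, N, (integral_card_closeSets hX hind n (k + 3) (3 * r n)).2]
      calc _ ≤ 2 ^ (k + 3) * ((n : ℝ) ^ (k + 3) *
            ((M * volume.real (Metric.closedBall (0 : EuclideanSpace ℝ (Fin d)) 1)) ^ (k + 2) *
              (3 * r n) ^ (d * (k + 2)))) := by
            gcongr
        _ = _ := by
            simp only [B]
            ring
  -- Any quantity within `C n` of the hollow count has the same normalised limit, which covers both
  -- expectations.
  have hclose : ∀ s : ℕ → ℝ, (∀ n, |s n - H n| ≤ C n) →
      Tendsto (fun n => s n / N n) atTop (𝓝 D) := by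
    intro s hs
    refine hH.congr_dist (squeeze_zero' (Eventually.of_forall fun _ => dist_nonneg) ?_ hC)
    filter_upwards [hN] with n hn
    rw [dist_comm, Real.dist_eq, ← sub_div, abs_div, abs_of_pos hn]
    exact div_le_div_of_nonneg_right (hs n) hn.le
  have hb := hclose _ fun n => (expectation_bounds hX hind F hk n (hr n)).1
  have hs := hclose _ fun n => (expectation_bounds hX hind F hk n (hr n)).2
  refine ⟨hb, ?_⟩
  have hdiv := hb.div hs hD.ne'
  rw [div_self hD.ne'] at hdiv
  refine hdiv.congr' ?_
  filter_upwards [hN] with n hn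
  exact div_div_div_cancel_right₀ hn.ne' _ _
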